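/- Let $k,l\ge 0$ be integers, $n=k+l$, $m=n-k+1=l+1$, let $\mathbb{T}^n=\prod_{i=1}^n\mathbb{R}/a_i\mathbb{Z}$ with $a_i>0$, and let $\lambda$ be the translation invariant probability measure on $\mathbb{T}^n$. Let $F:\mathbb{T}^n\to\mathbb{R}$ be a piecewise smooth function, meaning: $F$ is continuous; $F$ is $C^\infty$ off a closed set $S\subset\mathbb{T}^n$ such that the part of the graph of $F$ over $S$ has zero $n$-dimensional Hausdorff measure; and the graph has finite area ($|\mathrm{grad}\,F|$ is integrable over $\mathbb{T}^n$). Let $c$ be a constant with $F(x)<c$ for all $x$. Let $\mathbb{H}_-^{d}$ denote the set of vectors in $\mathbb{R}^d$ with negative last coordinate, and let $e$ be the last standard basis vector. A point particle moves as a billiard in $M=\{(x,z)\in\mathbb{T}^n\times\mathbb{R}: z\ge F(x)\}$: it moves along straight lines and is reflected specularly at the graph of $F$. For $x\in\mathbb{T}^n$ and $\xi\in\mathbb{H}_-^{n+1}$, let the trajectory start at $(x,c)$ with velocity $\xi$. If the trajectory returns to the plane $z=c$ after finitely many collisions, all of them transversal and at points where the graph has a tangent plane, let $\xi'\in\mathbb{H}_-^{n+1}$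 be its velocity at the return, reflected in that plane. Write $\mathbb{H}_-^{n+1}=\mathbb{R}^k\times\mathbb{H}_-^m$ (the first $k$ velocity components are hidden, the others observed). For $v\in\mathbb{H}_-^m$ and $w\in\mathbb{R}^k$ let $V(x,c,v,w)\in\mathbb{H}_-^m$ be the observed component of $\xi'$ for $\xi=(w,v)$. Given a probability measure $\mu$ on $\mathbb{R}^k$, the scattering operator is $$(P\Phi)(v)=\int_{\mathbb{R}^k}\int_{\mathbb{T}^n}\Phi(V(x,c,v,w))\,d\lambda(x)\,d\mu(w),$$ for $\Phi:\mathbb{H}_-^m\to\mathbb{R}$ continuous with compact support, where the integrand is taken to be $0$ when $V$ is undefined. A probability measure $\eta$ on $\mathbb{H}_-^m$ is called stationary for $P$ if $V(x,c,v,w)$ is defined for $\eta$-almost every $v$, $\mu$-almost every $w$ and $\lambda$-almost every $x$, and if $P\Phi$ is $\eta$-integrable with $\int P\Phi\,d\eta=\int\Phi\,d\eta$ for every continuous compactly supported $\Phi$ on $\mathbb{H}_-^m$. A finite non-zero measure is called stationary if its normalization to a probability measure is. **Proposition.** 1. Let $k=0$. The measure $d\eta(v)=|\langle v,e\rangle|\,d\omega(v)$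 on the unit hemisphere $\{v\in\mathbb{H}_-^m:|v|=1\}$, where $\omega$ is Euclidean surface measure, is finite, non-zero and stationary for $P$. The linear projection $(x,x_m)\mapsto x$ maps the unit hemisphere bijectively onto $D^{m-1}=\{x\in\mathbb{R}^{m-1}:|x|<1\}$ and maps the normalization of $\eta$ to the normalized Lebesgue measure on $D^{m-1}$. 2. Let $k>0$, let $\sigma>0$, and let $\mu$ be the Gaussian measure $d\mu(w)=(2\pi\sigma^2)^{-k/2}e^{-|w|^2/(2\sigma^2)}\,dw$ on $\mathbb{R}^k$. Then the post-collision Maxwell–Boltzmann measure $d\eta(v)=|\langle v,e\rangle|\,e^{-|v|^2/(2\sigma^2)}\,dV(v)$ on $\mathbb{H}_-^m$ is finite, non-zero and stationary for $P$. -/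

import Mathlib

open MeasureTheory Set
open scoped ContDiff

noncomputable section

namespace RandomBilliard

/-- Euclidean space `ℝⁿ`. -/
abbrev E (n : ℕ) : Type := EuclideanSpace ℝ (Fin n)

/-- The torus `𝕋ⁿ = ∏ ℝ / a i ℤ`. -/
abbrev Torus {n : ℕ} (a : Fin n → ℝ) : Type := (i : Fin n) → AddCircle (a i)

/-- The covering map `ℝⁿ → 𝕋ⁿ`. -/
def toTorus {n : ℕ} (a : Fin n → ℝ) (y : E n) : Torus a := fun i => (y i : AddCircle (a i))

/-- The uniform (translation invariant) probability measure `λ` on the torus. -/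
def uniform {n : ℕ} (a : Fin n → ℝ) [∀ i, Fact (0 < a i)] : Measure (Torus a) :=
  Measure.pi fun i => (AddCircle.haarAddCircle : Measure (AddCircle (a i)))

/-- `F : 𝕋ⁿ → ℝ` is piecewise smooth: `F` is continuous, and there is a closed exceptional set `S`
in the torus such that `F` is `C^∞` off `S`, the part of the graph lying over `S` is negligible
for `n`-dimensional area, and the smooth part of the graph has finite area over one
period (local integrability of `|grad F|` on the cover, which is the same as that of
`√(1 + |grad F|²)`). The last two conditions hold automatically if the torus is cut by finitely
many hypersurfaces into closed pieces, up to the boundary of which `F` is smooth. -/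
structure IsPiecewiseSmooth {n : ℕ} {a : Fin n → ℝ} (F : Torus a → ℝ) : Prop where
  continuous : Continuous F
  smooth_off : ∃ S : Set (Torus a), IsClosed S ∧
    ContDiffOn ℝ ∞ (fun y : E n => F (toTorus a y)) {y | toTorus a y ∉ S} ∧
    Measure.hausdorffMeasure (n : ℝ)
      {p : E n × ℝ | toTorus a p.1 ∈ S ∧ p.2 = F (toTorus a p.1)} = 0
  locallyIntegrable_fderiv :
    LocallyIntegrable (fun y : E n => ‖fderiv ℝ (fun y : E n => F (toTorus a y)) y‖) volume

/-- `F` read in the standard coordinates of the torus centred at `x`. -/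
def chart {n : ℕ} {a : Fin n → ℝ} (F : Torus a → ℝ) (x : Torus a) (y : E n) : ℝ :=
  F (x + toTorus a y)

/-- The gradient of `F` at the point `x` of the torus. -/
def grad {n : ℕ} {a : Fin n → ℝ} (F : Torus a → ℝ) (x : Torus a) : E n :=
  gradient (chart F x) 0

/-- The unit normal vector `(e - grad F) / √(1 + |grad F|²)` to the graph of `F` at `(x, F x)`,
where `e` is the last vector of the standard basis of `ℝⁿ⁺¹`. -/
def normal {n : ℕ} {a : Fin n → ℝ} (F : Torus a → ℝ) (x : Torus a) : E (n + 1) :=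
  (√(1 + ‖grad F x‖ ^ 2))⁻¹ •
    WithLp.toLp 2 (Fin.snoc (α := fun _ => ℝ) (fun i => -(grad F x i)) 1)

/-- A state of the point particle: position `(pos, height)` in `𝕋ⁿ × ℝ`
and velocity in `ℝⁿ⁺¹`. -/
structure State {n : ℕ} (a : Fin n → ℝ) where
  pos : Torus a
  height : ℝ
  vel : E (n + 1)

/-- The first `n` components of a vector of `ℝⁿ⁺¹`. -/
def horiz {n : ℕ} (ξ : E (n + 1)) : E n := WithLp.toLp 2 fun i : Fin n => ξ i.castSucc

/-- Straight motion for a time `t`. -/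
def State.fly {n : ℕ} {a : Fin n → ℝ} (s : State a) (t : ℝ) : State a where
  pos := s.pos + toTorus a (t • horiz s.vel)
  height := s.height + t * s.vel (Fin.last n)
  vel := s.vel

/-- Straight motion starting at `s` stays in the interior `{height > F}` of the configuration
manifold at all times strictly between `0` and `t`. -/
def FreeFlight {n : ℕ} {a : Fin n → ℝ} (F : Torus a → ℝ) (s : State a) (t : ℝ) : Prop :=
  0 < t ∧ ∀ r, 0 < r → r < t → F (s.fly r).pos < (s.fly r).height

/-- Specular reflection of the velocity `ξ` in the hyperplane orthogonal to the unit vector `ν`. -/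
def reflect {d : ℕ} (ν ξ : E d) : E d := ξ - (2 * inner ℝ ξ ν) • ν

/-- `s'` is the state of the billiard trajectory starting at `s` immediately after its next
collision: the particle moves freely until it reaches the graph of `F`, at a point where the graph
has a tangent plane and transversally to that plane, and is reflected specularly there. -/
def Collision {n : ℕ} {a : Fin n → ℝ} (F : Torus a → ℝ) (s s' : State a) : Prop :=
  ∃ t, FreeFlight F s t ∧
    (s.fly t).height = F (s.fly t).pos ∧
    DifferentiableAt ℝ (chart F (s.fly t).pos) 0 ∧
    inner ℝ s.vel (normal F (s.fly t).pos) < 0 ∧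
    s' = { pos := (s.fly t).pos
           height := (s.fly t).height
           vel := reflect (normal F (s.fly t).pos) s.vel }

/-- The billiard trajectory that starts at the point `x` of the reference plane `{height = c}`
with velocity `ξ` returns, after finitely many collisions, to the reference plane, and `V` is its
velocity at that moment, reflected in the reference plane (so that the last component is
negative again). All collisions take place below the reference plane, so this is the first
return. -/
def Returns {n : ℕ} {a : Fin n → ℝ} (F : Torus a → ℝ) (c : ℝ) (x : Torus a) (ξ V : E (n + 1)) :
    Prop :=
  ∃ s : State a, Relation.ReflTransGen (Collision F) { pos := x, height := c, vel := ξ } s ∧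
    ∃ t, FreeFlight F s t ∧ (s.fly t).height = c ∧
      V = reflect (EuclideanSpace.single (Fin.last n) 1) s.vel

open Classical in
/-- The velocity component of the deterministic scattering map. For initial conditions whose
trajectory hits a singular point of the boundary, grazes the boundary or never
returns, the value is `0`, which does not belong to the half-space of velocities. -/
def scatter {n : ℕ} {a : Fin n → ℝ} (F : Torus a → ℝ) (c : ℝ) (x : Torus a) (ξ : E (n + 1)) :
    E (n + 1) :=
  if h : ∃ V, Returns F c x ξ V then h.choose else 0

/-- The open lower half-space `ℍ₋` of `ℝ^(l+1)`. -/
def lowerHalf (l : ℕ) : Set (E (l + 1)) := {v | v (Fin.last l) < 0}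

/-- `ξ = (w, v)`, in the decomposition `ℝ^(k+l+1) = ℝ^k × ℝ^(l+1)` into hidden
and observed velocities. -/
def join {k l : ℕ} (w : E k) (v : E (l + 1)) : E (k + l + 1) :=
  WithLp.toLp 2 (Fin.append w.ofLp v.ofLp : Fin (k + (l + 1)) → ℝ)

/-- The observed component of `ξ ∈ ℝ^(k+l+1) = ℝ^k × ℝ^(l+1)`. -/
def observed {k l : ℕ} (ξ : E (k + l + 1)) : E (l + 1) :=
  WithLp.toLp 2 fun j : Fin (l + 1) => ξ (Fin.natAdd k j : Fin (k + (l + 1)))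

/-- The scattering operator `(P Φ)(v) = ∫_{ℝ^k} ∫_{𝕋ⁿ} Φ(V(x, c, v, w)) dλ(x) dμ(w)`. -/
def scatteringOp {k l : ℕ} {a : Fin (k + l) → ℝ} [∀ i, Fact (0 < a i)] (F : Torus a → ℝ) (c : ℝ)
    (μ : Measure (E k)) (Φ : E (l + 1) → ℝ) (v : E (l + 1)) : ℝ :=
  ∫ w, ∫ x, Φ (observed (scatter F c x (join w v))) ∂(uniform a) ∂μ

/-- The probability measure `η` on `ℍ₋` is stationary under `P`: for `η`-almost every `v` the
random scattering event with observed velocity `v` is almost surely defined, and `η P = η`,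
i.e. `η (P Φ) = η Φ` for all compactly supported continuous `Φ` on the half-space `ℍ₋`. -/
structure IsStationary {k l : ℕ} {a : Fin (k + l) → ℝ} [∀ i, Fact (0 < a i)] (F : Torus a → ℝ)
    (c : ℝ) (μ : Measure (E k)) (η : Measure (E (l + 1))) : Prop where
  isProbabilityMeasure : IsProbabilityMeasure η
  ae_mem : ∀ᵐ v ∂η, v ∈ lowerHalf l
  ae_returns : ∀ᵐ v ∂η, ∀ᵐ w ∂μ, ∀ᵐ x ∂(uniform a), ∃ V, Returns F c x (join w v) V
  invariant : ∀ Φ : E (l + 1) → ℝ, Continuous Φ → HasCompactSupport Φ → tsupport Φ ⊆ lowerHalf l →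
    Integrable (scatteringOp F c μ Φ) η ∧ ∫ v, scatteringOp F c μ Φ v ∂η = ∫ v, Φ v ∂η

/-- The multiple of `η` of total mass one (when `η` is finite and non-zero). -/
def normalized {X : Type} [MeasurableSpace X] (η : Measure X) : Measure X := (η univ)⁻¹ • η

/-- The Gaussian law of the hidden velocities in `ℝ^k`, with temperature `σ²`. -/
def hiddenGaussian (k : ℕ) (σ : ℝ) : Measure (E k) :=
  volume.withDensity fun w => ENNReal.ofReal
    (Real.exp (-(1 / 2) * ‖w‖ ^ 2 / σ ^ 2) / (2 * Real.pi * σ ^ 2) ^ ((k : ℝ) / 2))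

/-- The unit hemisphere in `ℍ₋`. -/
def hemisphere (l : ℕ) : Set (E (l + 1)) := Metric.sphere 0 1 ∩ lowerHalf l

/-- The Euclidean surface measure `ω` on the unit hemisphere, as a measure on `ℝ^(l+1)`. -/
def hemisphereMeasure (l : ℕ) : Measure (E (l + 1)) :=
  ((volume : Measure (E (l + 1))).toSphere.map Subtype.val).restrict (lowerHalf l)

/-- The cosine-weighted measure `|⟨v, e⟩| dω(v)` on the unit hemisphere. -/
def cosineMeasure (l : ℕ) : Measure (E (l + 1)) :=
  (hemisphereMeasure l).withDensity fun v => ENNReal.ofReal |v (Fin.last l)|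

/-- The post-collision Maxwell-Boltzmann measure `|⟨v, e⟩| exp (-|v|² / (2σ²)) dV(v)` on `ℍ₋`. -/
def maxwellBoltzmann (l : ℕ) (σ : ℝ) : Measure (E (l + 1)) :=
  (volume.restrict (lowerHalf l)).withDensity fun v => ENNReal.ofReal
    (|v (Fin.last l)| * Real.exp (-(1 / 2) * ‖v‖ ^ 2 / σ ^ 2))

end RandomBilliard

end

/-! Close the billiard table with a flat lid at height `c`. On pairs of a boundary point and an
outgoing velocity, the billiard map is a free flight followed by a reflection. It preserves the flux
measure, which is horizontal area times a velocity law `ν`, weighted by the positive part of `flux`,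
whenever `ν` satisfies `IsReflectionInvariant`. There are two reasons. At a fixed velocity `v`, the
flux through a piece of boundary with injective projection is `|v_last|` times the area of its
shadow cast along `v` on the lid. A flight does not change shadows, so it carries the flux of `v` to
the flux of `-v` at the landing points (`IsPiecewiseSmooth.map_land`). At a fixed boundary point,
the reflection reverses the sign of the flux and preserves `ν`
(`IsPiecewiseSmooth.measurePreserving_billiardStep`). Singular and grazing collisions do not matter,
because for each non-horizontal velocity their shadows are null: by the Hausdorff measure assumption
and by the easy case of Sard's theorem.

The flux measure is finite, since the graph has finite area and `ν` a finite first moment. By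
Poincaré recurrence almost every trajectory leaving the lid returns to it, and the first return map
preserves the flux measure on the lid (`map_returnMap`), which is the product of `uniform a` and
`downMeasure ν`. The velocity component of the return map is `scatter` almost everywhere, so
scattering preserves `downMeasure ν` (`IsPiecewiseSmooth.scatter_invariant`).

Hence `η` is stationary once the joint law of hidden and observed velocities is proportional to some
`downMeasure ν` (`IsPiecewiseSmooth.isStationary`). For a Gaussian `ν` this law splits into a hidden
Gaussian and an observed Maxwell–Boltzmann factor; for `k = 0`, surface measure on the sphere gives
the cosine law. The cosine weight is exactly the factor by which projection to the ball contracts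
area, whence Lebesgue measure there. -/

noncomputable section

namespace RandomBilliard

/-! ### The torus, its covering map and its uniform measure. -/

section

variable {n : ℕ} {a : Fin n → ℝ}

/-- The half-open fundamental box of the lattice `∏ a i ℤ`. -/
def box (a : Fin n → ℝ) : Set (E n) := {y | ∀ i, y i ∈ Ioc 0 (0 + a i)}

/-- The vectors of the lattice `∏ a i ℤ`. -/
def latticeVec (a : Fin n → ℝ) (g : Fin n → ℤ) : E n := WithLp.toLp 2 fun i => g i • a i

/-- The reciprocal of the volume of the torus. -/
def density (a : Fin n → ℝ) : ENNReal := ∏ i, (ENNReal.ofReal (a i))⁻¹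

theorem toTorus_add (y z : E n) : toTorus a (y + z) = toTorus a y + toTorus a z := by
  ext i; simp [toTorus]

theorem toTorus_sub (y z : E n) : toTorus a (y - z) = toTorus a y - toTorus a z := by
  ext i; simp [toTorus]

theorem toTorus_zero : toTorus a (0 : E n) = 0 := by
  ext i; simp [toTorus]

theorem continuous_toTorus : Continuous (toTorus a) := by
  refine continuous_pi fun i => ?_
  exact (AddCircle.continuous_mk' (a i)).comp (by fun_prop)

theorem toTorus_latticeVec (g : Fin n → ℤ) : toTorus a (latticeVec a g) = 0 := by
  ext i
  simp only [toTorus, latticeVec, Pi.zero_apply, AddCircle.coe_eq_zero_iff]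
  exact ⟨g i, rfl⟩

theorem measurableSet_box : MeasurableSet (box a) := by
  have : box a = ⋂ i, (fun y : E n => y i) ⁻¹' Ioc 0 (0 + a i) := by ext; simp [box]
  rw [this]
  refine MeasurableSet.iInter fun i => measurableSet_Ioc.preimage ?_
  exact Continuous.measurable (by fun_prop)

theorem measurableSet_toTorus_image {B : Set (E n)} (hB : MeasurableSet B)
    (h : InjOn (toTorus a) B) : MeasurableSet (toTorus a '' B) :=
  hB.image_of_continuousOn_injOn continuous_toTorus.continuousOn h

variable [∀ i, Fact (0 < a i)]

theorem injOn_toTorus_box : InjOn (toTorus a) (box a) := by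
  intro y hy z hz h
  ext i
  exact (AddCircle.coe_eq_coe_iff_of_mem_Ioc (hy i) (hz i)).1 (congrFun h i)

theorem exists_sub_latticeVec_mem_box (y : E n) : ∃ g, y - latticeVec a g ∈ box a := by
  refine ⟨fun i => toIocDiv (Fact.out : 0 < a i) 0 (y i), fun i => ?_⟩
  exact toIocMod_mem_Ioc (Fact.out : 0 < a i) 0 (y i)

theorem exists_mem_box (x : Torus a) : ∃ y ∈ box a, toTorus a y = x := by
  choose y hy using fun i => QuotientAddGroup.mk_surjective (x i)
  obtain ⟨g, hg⟩ := exists_sub_latticeVec_mem_box (a := a) (WithLp.toLp 2 y)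
  refine ⟨_, hg, ?_⟩
  rw [toTorus_sub, toTorus_latticeVec, sub_zero]
  exact funext hy

theorem density_ne_top : density a ≠ ⊤ := by
  refine ENNReal.prod_ne_top fun i _ => ?_
  simpa using (Fact.out : 0 < a i)

instance : IsProbabilityMeasure (uniform a) := by
  unfold uniform; infer_instance

theorem uniform_eq : uniform a = density a • (volume.restrict (box a)).map (toTorus a) := by
  have h1 : ∀ i, MeasurePreserving (fun y : ℝ => (y : AddCircle (a i)))
      ((ENNReal.ofReal (a i))⁻¹ • volume.restrict (Ioc 0 (0 + a i)))
      (AddCircle.haarAddCircle : Measure (AddCircle (a i))) := by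
    intro i
    have h0 : 0 < a i := Fact.out
    have := (AddCircle.measurePreserving_mk (a i) 0).smul_measure (ENNReal.ofReal (a i))⁻¹
    rw [AddCircle.volume_eq_smul_haarAddCircle, smul_smul, ENNReal.inv_mul_cancel (by simpa using h0)
      (by simp), one_smul] at this
    exact this
  have hfin : ∀ i, IsFiniteMeasure
      ((ENNReal.ofReal (a i))⁻¹ • (volume : Measure ℝ).restrict (Ioc 0 (0 + a i))) := by
    intro i
    refine Measure.smul_finite _ ?_
    simpa using (Fact.out : 0 < a i)
  have h2 := measurePreserving_pi _ _ h1
  have h3 : Measure.pi (fun i => (ENNReal.ofReal (a i))⁻¹ •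
      (volume : Measure ℝ).restrict (Ioc 0 (0 + a i))) =
      density a • (volume : Measure (Fin n → ℝ)).restrict (univ.pi fun i => Ioc 0 (0 + a i)) := by
    refine Measure.pi_eq fun s hs => ?_
    rw [volume_pi, Measure.restrict_pi_pi, Measure.smul_apply, Measure.pi_pi]
    simp [density, Finset.prod_mul_distrib]
  rw [h3] at h2
  have h4 : MeasurePreserving (@WithLp.ofLp 2 (Fin n → ℝ)) (volume.restrict (box a))
      ((volume : Measure (Fin n → ℝ)).restrict (univ.pi fun i => Ioc 0 (0 + a i))) := by
    have := (PiLp.volume_preserving_ofLp (Fin n)).restrict_preimage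
      (s := univ.pi fun i => Ioc 0 (0 + a i)) (MeasurableSet.univ_pi fun i => measurableSet_Ioc)
    have hb : box a = WithLp.ofLp ⁻¹' univ.pi fun i => Ioc 0 (0 + a i) := by
      ext y
      simp only [box, mem_ofPred_eq, mem_preimage, mem_pi, mem_univ, true_implies]
    rw [hb]
    exact this
  have h5 := h2.comp (h4.smul_measure (density a))
  rw [← Measure.map_smul]
  exact h5.map_eq.symm

theorem uniform_apply {A : Set (Torus a)} (hA : MeasurableSet A) :
    uniform a A = density a * volume (box a ∩ toTorus a ⁻¹' A) := by
  rw [uniform_eq, Measure.smul_apply, Measure.map_apply continuous_toTorus.measurable hA,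
    Measure.restrict_apply (continuous_toTorus.measurable hA), inter_comm, smul_eq_mul]

theorem lintegral_uniform {g : Torus a → ENNReal} (hg : Measurable g) :
    ∫⁻ x, g x ∂(uniform a) = density a * ∫⁻ y in box a, g (toTorus a y) := by
  rw [uniform_eq, lintegral_smul_measure, lintegral_map hg continuous_toTorus.measurable, smul_eq_mul]

/-- The covering map multiplies the volume of sets on which it is injective by a constant. -/
theorem uniform_toTorus_image {B : Set (E n)} (hB : MeasurableSet B) (h : InjOn (toTorus a) B) :
    uniform a (toTorus a '' B) = density a * volume B := by
  -- Cut `B` along the lattice translates of the box: a lattice vector moves each piece into the box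
  -- and changes neither its volume nor its image in the torus.
  let P : (Fin n → ℤ) → Set (E n) := fun g => B ∩ (fun y => y - latticeVec a g) ⁻¹' box a
  have hPm : ∀ g, MeasurableSet (P g) := fun g =>
    hB.inter (measurableSet_box.preimage (by fun_prop))
  have hBP : B = ⋃ g, P g := by
    ext y
    simp only [P, mem_iUnion, mem_inter_iff, mem_preimage]
    refine ⟨fun hy => ?_, fun ⟨_, hy, _⟩ => hy⟩
    obtain ⟨g, hg⟩ := exists_sub_latticeVec_mem_box (a := a) y
    exact ⟨g, hy, hg⟩
  have hPd : Pairwise (Function.onFun Disjoint P) := by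
    intro g g' hgg
    refine Set.disjoint_left.2 fun y hy hy' => hgg ?_
    have h1 : y - latticeVec a g = y - latticeVec a g' := by
      refine injOn_toTorus_box (a := a) hy.2 hy'.2 ?_
      rw [toTorus_sub, toTorus_sub, toTorus_latticeVec, toTorus_latticeVec]
    funext i
    have h2 : latticeVec a g i = latticeVec a g' i := by
      rw [sub_right_injective h1]
    have h0 : a i ≠ 0 := (Fact.out : 0 < a i).ne'
    simpa [latticeVec, h0] using h2
  have hP : ∀ g, uniform a (toTorus a '' P g) = density a * volume (P g) := by
    intro g
    have hi : InjOn (toTorus a) (P g) := h.mono inter_subset_left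
    rw [uniform_apply (measurableSet_toTorus_image (hPm g) hi)]
    congr 1
    rw [← measure_preimage_add_right volume (latticeVec a g) (P g)]
    congr 1
    ext y
    simp only [mem_inter_iff, mem_preimage, mem_image, P, add_sub_cancel_right]
    constructor
    · rintro ⟨hy, z, ⟨hz, hzb⟩, hzy⟩
      have : z - latticeVec a g = y := by
        refine injOn_toTorus_box (a := a) hzb hy ?_
        rw [toTorus_sub, toTorus_latticeVec, sub_zero, hzy]
      subst this
      simpa using ⟨hz, hzb⟩
    · rintro ⟨hy, hb⟩
      refine ⟨hb, _, ⟨hy, by simpa using hb⟩, ?_⟩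
      rw [toTorus_add, toTorus_latticeVec, add_zero]
  conv_lhs => rw [hBP, image_iUnion]
  rw [measure_iUnion, hBP, measure_iUnion hPd hPm, ← ENNReal.tsum_mul_left]
  · exact tsum_congr hP
  · intro g g' hgg
    refine Set.disjoint_left.2 ?_
    rintro _ ⟨y, hy, rfl⟩ ⟨z, hz, hzy⟩
    rw [h hz.1 hy.1 hzy] at hz
    exact Set.disjoint_left.1 (hPd hgg) hy hz
  · exact fun g => measurableSet_toTorus_image (hPm g) (h.mono inter_subset_left)

/-- Null sets need no injectivity, since countably many translates of the box cover everything and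
the covering map is injective on each. -/
theorem uniform_toTorus_image_eq_zero {B : Set (E n)} (hB : volume B = 0) :
    uniform a (toTorus a '' B) = 0 := by
  obtain ⟨B', hBB, hm, h0⟩ := exists_measurable_superset_of_null hB
  refine measure_mono_null (t := ⋃ g, toTorus a ''
    (B' ∩ (fun y => y - latticeVec a g) ⁻¹' box a)) ?_ (measure_iUnion_null fun g => ?_)
  · rintro _ ⟨y, hy, rfl⟩
    obtain ⟨g, hg⟩ := exists_sub_latticeVec_mem_box (a := a) y
    exact mem_iUnion.2 ⟨g, y, ⟨hBB hy, hg⟩, rfl⟩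
  · rw [uniform_toTorus_image (hm.inter (measurableSet_box.preimage (by fun_prop)))]
    · rw [measure_mono_null inter_subset_left h0, mul_zero]
    · intro y hy z hz hyz
      have := injOn_toTorus_box (a := a) hy.2 hz.2 (by
        rw [toTorus_sub, toTorus_sub, hyz])
      exact sub_left_injective this

end

/-! ### Projection of the graph to the lid along a fixed velocity. -/

section

variable {n : ℕ} {a : Fin n → ℝ}

/-- The points of the torus over which the graph of `F` has a tangent plane. -/
def diffPts (F : Torus a → ℝ) : Set (Torus a) := {x | DifferentiableAt ℝ (chart F x) 0}

/-- The derivative along a trajectory of velocity `v` of its height above the graph of `F`. -/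
def vertSpeed (F : Torus a → ℝ) (v : E (n + 1)) (x : Torus a) : ℝ :=
  v (Fin.last n) - inner ℝ (grad F x) (horiz v)

/-- The projection of the graph of `F` to the plane of height `c` in the direction `v`. -/
def slide (F : Torus a → ℝ) (c : ℝ) (v : E (n + 1)) (x : Torus a) : Torus a :=
  x + toTorus a (((c - F x) / v (Fin.last n)) • horiz v)

/-- The lift of `slide` to the universal cover. -/
def slideLift (F : Torus a → ℝ) (c : ℝ) (v : E (n + 1)) (y : E n) : E n :=
  y + ((c - F (toTorus a y)) / v (Fin.last n)) • horiz v

theorem toTorus_slideLift (F : Torus a → ℝ) (c : ℝ) (v : E (n + 1)) (y : E n) :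
    toTorus a (slideLift F c v y) = slide F c v (toTorus a y) := by
  simp only [slideLift, slide, toTorus_add]

theorem chart_toTorus (F : Torus a → ℝ) (y : E n) :
    chart F (toTorus a y) = fun u => F (toTorus a (y + u)) := by
  funext u; simp only [chart, toTorus_add]

theorem continuous_uncurry_chart {F : Torus a → ℝ} (hF : Continuous F) :
    Continuous (Function.uncurry (chart F)) := by
  unfold chart Function.uncurry
  have := continuous_toTorus (a := a)
  fun_prop

theorem measurableSet_diffPts {F : Torus a → ℝ} (hF : Continuous F) :
    MeasurableSet (diffPts F) :=
  (measurableSet_of_differentiableAt_with_param ℝ (continuous_uncurry_chart hF)).preimage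
    (measurable_id.prodMk measurable_const : Measurable fun x : Torus a => (x, (0 : E n)))

theorem measurable_grad {F : Torus a → ℝ} (hF : Continuous F) : Measurable (grad F) := by
  have h1 := (measurable_fderiv_with_param ℝ (continuous_uncurry_chart hF)).comp
    (measurable_id.prodMk measurable_const : Measurable fun x : Torus a => (x, (0 : E n)))
  exact (InnerProductSpace.toDual ℝ (E n)).symm.continuous.measurable.comp h1

theorem continuous_horiz : Continuous (horiz : E (n + 1) → E n) := by
  unfold horiz; fun_prop

theorem measurable_vertSpeed {F : Torus a → ℝ} (hF : Continuous F) :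
    Measurable fun q : Torus a × E (n + 1) => vertSpeed F q.2 q.1 := by
  unfold vertSpeed
  refine Measurable.sub ?_ (Measurable.inner ((measurable_grad hF).comp measurable_fst)
    (continuous_horiz.measurable.comp measurable_snd))
  exact (Continuous.measurable (by fun_prop) : Measurable fun v : E (n + 1) => v (Fin.last n)).comp
    measurable_snd

theorem inner_grad (F : Torus a → ℝ) (x : Torus a) (u : E n) :
    inner ℝ (grad F x) u = fderiv ℝ (chart F x) 0 u := by
  simp only [grad, gradient, InnerProductSpace.toDual_symm_apply]

theorem hasFDerivAt_lift {F : Torus a → ℝ} {y : E n} (hy : toTorus a y ∈ diffPts F) :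
    HasFDerivAt (fun y => F (toTorus a y)) (fderiv ℝ (chart F (toTorus a y)) 0) y := by
  have h0 : DifferentiableAt ℝ (chart F (toTorus a y)) (y - y) := by
    rw [sub_self]
    exact hy
  have h2 : HasFDerivAt (fun z => chart F (toTorus a y) (z - y))
      (fderiv ℝ (chart F (toTorus a y)) 0) y := by
    have h3 : HasFDerivAt (fun z : E n => z - y) (ContinuousLinearMap.id ℝ (E n)) y :=
      (hasFDerivAt_id y).sub_const y
    have := HasFDerivAt.comp (f := fun z : E n => z - y) y h0.hasFDerivAt h3
    rw [sub_self] at this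
    exact this
  refine h2.congr_of_eventuallyEq (Filter.Eventually.of_forall fun z => ?_)
  simp only [chart_toTorus, add_sub_cancel]

/-- The derivative of `slideLift`. -/
def slideDeriv (F : Torus a → ℝ) (v : E (n + 1)) (x : Torus a) : E n →L[ℝ] E n :=
  ContinuousLinearMap.id ℝ (E n) +
    (-(v (Fin.last n))⁻¹ • fderiv ℝ (chart F x) 0).smulRight (horiz v)

theorem hasFDerivAt_slideLift {F : Torus a → ℝ} (c : ℝ) (v : E (n + 1)) {y : E n}
    (hy : toTorus a y ∈ diffPts F) :
    HasFDerivAt (slideLift F c v) (slideDeriv F v (toTorus a y)) y := by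
  refine (hasFDerivAt_id y).add (HasFDerivAt.smul_const ?_ _)
  have := ((hasFDerivAt_lift hy).const_sub c).mul_const (v (Fin.last n))⁻¹
  simpa [div_eq_mul_inv] using this

/-- The derivative is a rank one perturbation of the identity, so its determinant is one plus the
functional applied to `horiz v`. This makes the flux density the Jacobian of the shadow map, up to
the factor `v_last`. -/
theorem det_slideDeriv (F : Torus a → ℝ) {v : E (n + 1)} (hv : v (Fin.last n) ≠ 0)
    (x : Torus a) : (slideDeriv F v x).det = vertSpeed F v x / v (Fin.last n) := by
  have : ((slideDeriv F v x : E n →L[ℝ] E n) : E n →ₗ[ℝ] E n) = LinearMap.transvection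
      ((-(v (Fin.last n))⁻¹ • fderiv ℝ (chart F x) 0 : E n →L[ℝ] ℝ) : E n →ₗ[ℝ] ℝ) (horiz v) := by
    ext u : 1
    simp [slideDeriv, LinearMap.transvection]
  rw [ContinuousLinearMap.det, this, LinearMap.transvection.det, vertSpeed, inner_grad]
  simp
  field_simp
  ring

/-- Change of variables for the shadow map, done on the universal cover and brought back to the
torus. -/
theorem lintegral_abs_vertSpeed [∀ i, Fact (0 < a i)] {F : Torus a → ℝ} (hF : Continuous F) (c : ℝ)
    {v : E (n + 1)} (hv : v (Fin.last n) ≠ 0) {A : Set (Torus a)} (hA : MeasurableSet A)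
    (hAF : A ⊆ diffPts F) (hinj : InjOn (slide F c v) A) :
    ∫⁻ x in A, ENNReal.ofReal |vertSpeed F v x| ∂(uniform a) =
      ENNReal.ofReal |v (Fin.last n)| * uniform a (slide F c v '' A) := by
  set B := box a ∩ toTorus a ⁻¹' A with hB
  have hBm : MeasurableSet B := measurableSet_box.inter (continuous_toTorus.measurable hA)
  have hd : ∀ y ∈ B, HasFDerivWithinAt (slideLift F c v) (slideDeriv F v (toTorus a y)) B y :=
    fun y hy => (hasFDerivAt_slideLift c v (hAF hy.2)).hasFDerivWithinAt
  have hcomp : InjOn (fun y => toTorus a (slideLift F c v y)) B := by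
    intro y hy z hz h
    simp only [toTorus_slideLift] at h
    exact injOn_toTorus_box hy.1 hz.1 (hinj hy.2 hz.2 h)
  have hi : InjOn (slideLift F c v) B := fun y hy z hz h => hcomp hy hz (congrArg _ h)
  have hi2 : InjOn (toTorus a) (slideLift F c v '' B) := by
    rintro _ ⟨y, hy, rfl⟩ _ ⟨z, hz, rfl⟩ h
    exact congrArg _ (hcomp hy hz h)
  have himg : slide F c v '' A = toTorus a '' (slideLift F c v '' B) := by
    rw [image_image]
    simp only [toTorus_slideLift]
    ext x
    constructor
    · rintro ⟨y, hy, rfl⟩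
      obtain ⟨z, hz, rfl⟩ := exists_mem_box y
      exact ⟨z, ⟨hz, hy⟩, rfl⟩
    · rintro ⟨z, hz, rfl⟩
      exact ⟨_, hz.2, rfl⟩
  have hJ : Measurable fun x => ENNReal.ofReal |vertSpeed F v x| :=
    ((measurable_vertSpeed hF).comp (measurable_id.prodMk measurable_const)).abs.ennreal_ofReal
  rw [himg, uniform_toTorus_image (measurable_image_of_fderivWithin hBm hd hi) hi2,
    ← lintegral_abs_det_fderiv_eq_addHaar_image volume hBm hd hi, ← lintegral_indicator hA,
    lintegral_uniform (hJ.indicator hA), mul_left_comm]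
  congr 1
  rw [← lintegral_const_mul' _ _ (by simp)]
  have : ∀ y, A.indicator (fun x => ENNReal.ofReal |vertSpeed F v x|) (toTorus a y) =
      (toTorus a ⁻¹' A).indicator (fun y => ENNReal.ofReal |vertSpeed F v (toTorus a y)|) y :=
    fun y => rfl
  simp only [this]
  rw [lintegral_indicator (continuous_toTorus.measurable hA),
    Measure.restrict_restrict (continuous_toTorus.measurable hA), inter_comm]
  refine lintegral_congr fun y => ?_
  rw [det_slideDeriv F hv, ← ENNReal.ofReal_mul (abs_nonneg _), ← abs_mul,
    mul_div_cancel₀ _ hv]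

/-- The easy case of Sard's theorem: the determinant of the derivative vanishes exactly at grazing
points. No injectivity is required. -/
theorem uniform_slide_image_of_vertSpeed_eq_zero [∀ i, Fact (0 < a i)] (F : Torus a → ℝ)
    (c : ℝ) {v : E (n + 1)} (hv : v (Fin.last n) ≠ 0) {A : Set (Torus a)}
    (hAF : A ⊆ diffPts F) (h0 : ∀ x ∈ A, vertSpeed F v x = 0) :
    uniform a (slide F c v '' A) = 0 := by
  have himg : slide F c v '' A ⊆ toTorus a '' (slideLift F c v '' (toTorus a ⁻¹' A)) := by
    rw [image_image]
    simp only [toTorus_slideLift]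
    rintro _ ⟨y, hy, rfl⟩
    obtain ⟨z, hz, rfl⟩ := exists_mem_box y
    exact ⟨z, hy, rfl⟩
  refine measure_mono_null himg (uniform_toTorus_image_eq_zero ?_)
  refine addHaar_image_eq_zero_of_det_fderivWithin_eq_zero volume
    (fun y hy => (hasFDerivAt_slideLift c v (hAF hy)).hasFDerivWithinAt) fun y hy => ?_
  rw [det_slideDeriv F hv, h0 _ hy, zero_div]

/-- Lipschitz maps keep Hausdorff null sets null. The detour through `ofLp` is there because
Hausdorff measure is identified with Lebesgue measure in the sup metric of `Fin n → ℝ`. -/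
theorem volume_image_eq_zero_of_hausdorffMeasure {G : Set (E n × ℝ)}
    (hG : Measure.hausdorffMeasure (n : ℝ) G = 0) {f : E n × ℝ → E n} {K : NNReal}
    (hf : LipschitzWith K f) : volume (f '' G) = 0 := by
  have h1 := ((PiLp.lipschitzWith_ofLp 2 (fun _ : Fin n => ℝ)).comp hf).hausdorffMeasure_image_le
    (d := n) (by positivity) G
  rw [hG, mul_zero] at h1
  have h2 : volume (WithLp.ofLp '' (f '' G)) = 0 := by
    rw [← hausdorffMeasure_pi_real, Fintype.card_fin, ← image_comp]
    exact le_antisymm h1 zero_le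
  have h3 := (PiLp.volume_preserving_ofLp (Fin n)).quasiMeasurePreserving.preimage_null h2
  exact measure_mono_null (subset_preimage_image _ _) h3

/-- As a function of `x` the shadow is only continuous, but as a function of the graph point `(y, F
y)` it is affine, hence Lipschitz. This is why the exceptional part is required to be null on the
graph and not merely in the torus. -/
theorem IsPiecewiseSmooth.uniform_slide_image_compl_diffPts [∀ i, Fact (0 < a i)]
    {F : Torus a → ℝ} (hF : IsPiecewiseSmooth F) (c : ℝ) (v : E (n + 1)) :
    uniform a (slide F c v '' (diffPts F)ᶜ) = 0 := by
  obtain ⟨S, hS, hd, h0⟩ := hF.smooth_off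
  have hsub : (diffPts F)ᶜ ⊆ S := by
    intro x hx
    by_contra hxS
    obtain ⟨y, hy, rfl⟩ := exists_mem_box x
    refine hx ?_
    have hopen : IsOpen {y | toTorus a y ∉ S} := hS.isOpen_compl.preimage continuous_toTorus
    have h1 := (hd.contDiffAt (hopen.mem_nhds hxS)).differentiableAt (by simp)
    change DifferentiableAt ℝ (chart F (toTorus a y)) 0
    rw [chart_toTorus]
    have h2 : DifferentiableAt ℝ (fun u : E n => y + u) 0 := by fun_prop
    exact DifferentiableAt.comp (g := fun y => F (toTorus a y)) (0 : E n) (by simpa using h1) h2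
  have hL : LipschitzWith (1 + ‖((ContinuousLinearMap.snd ℝ (E n) ℝ).smulRight
      (-(v (Fin.last n))⁻¹ • horiz v))‖₊ + 0) (fun p : E n × ℝ => p.1 +
        ((ContinuousLinearMap.snd ℝ (E n) ℝ).smulRight (-(v (Fin.last n))⁻¹ • horiz v)) p +
          (c / v (Fin.last n)) • horiz v) :=
    (LipschitzWith.prod_fst.add (ContinuousLinearMap.lipschitz _)).add (LipschitzWith.const _)
  refine measure_mono_null ?_ (uniform_toTorus_image_eq_zero
    (volume_image_eq_zero_of_hausdorffMeasure h0 hL))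
  rintro _ ⟨x, hx, rfl⟩
  obtain ⟨y, hy, rfl⟩ := exists_mem_box x
  refine ⟨_, ⟨(y, F (toTorus a y)), ⟨hsub hx, rfl⟩, rfl⟩, ?_⟩
  rw [← toTorus_slideLift]
  congr 1
  simp only [slideLift, ContinuousLinearMap.smulRight_apply, ContinuousLinearMap.coe_snd',
    div_eq_mul_inv, sub_mul, sub_smul, smul_smul]
  rw [add_assoc, mul_neg, neg_smul]
  abel_nf

theorem IsPiecewiseSmooth.uniform_compl_diffPts [∀ i, Fact (0 < a i)]
    {F : Torus a → ℝ} (hF : IsPiecewiseSmooth F) : uniform a (diffPts F)ᶜ = 0 := by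
  -- At velocity `0` the slide is the identity, so the statement on shadows becomes one on the set
  -- itself.
  have := hF.uniform_slide_image_compl_diffPts 0 0
  have h : slide F 0 (0 : E (n + 1)) = id := by
    funext x
    have : horiz (0 : E (n + 1)) = 0 := rfl
    simp [slide, toTorus_zero]
  rwa [h, image_id] at this

end

/-! ### Free flight in the region below the lid: exit times and landing points. -/

section

variable {n : ℕ} {a : Fin n → ℝ}

/-- Straight motion with velocity `v` for a time `r` in `𝕋ⁿ × ℝ`. -/
def move (v : E (n + 1)) (r : ℝ) (q : Torus a × ℝ) : Torus a × ℝ :=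
  (q.1 + toTorus a (r • horiz v), q.2 + r * v (Fin.last n))

/-- The open region between the graph of `F` and the plane of height `c`. -/
def region (F : Torus a → ℝ) (c : ℝ) : Set (Torus a × ℝ) := {q | F q.1 < q.2 ∧ q.2 < c}

/-- The boundary of `region F c`: the union of the graph and the plane. -/
def wall (F : Torus a → ℝ) (c : ℝ) : Set (Torus a × ℝ) := {q | q.2 = c ∨ q.2 = F q.1}

/-- The motion from `q` with velocity `v` stays in the region at all times in `(0, s)`. -/
def Free (F : Torus a → ℝ) (c : ℝ) (v : E (n + 1)) (q : Torus a × ℝ) (s : ℝ) : Prop :=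
  ∀ r, 0 < r → r < s → move v r q ∈ region F c

/-- The points of the boundary with a tangent plane. -/
def smoothWall (F : Torus a → ℝ) (c : ℝ) : Set (Torus a × ℝ) :=
  {q | q.2 = c ∨ q.2 = F q.1 ∧ q.1 ∈ diffPts F}

open Classical in
/-- The flux density of the velocity `v` at the boundary point `q`, in the direction of the
interior and per unit of horizontal area. -/
def flux (F : Torus a → ℝ) (c : ℝ) (v : E (n + 1)) (q : Torus a × ℝ) : ℝ :=
  if q.2 = c then -v (Fin.last n) else vertSpeed F v q.1

/-- The boundary points where `v` points strictly into the region. -/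
def outPts (F : Torus a → ℝ) (c : ℝ) (v : E (n + 1)) : Set (Torus a × ℝ) :=
  {q | q ∈ smoothWall F c ∧ 0 < flux F c v q}

/-- The time after which the motion from `q` with velocity `v` leaves the region. -/
def exitTime (F : Torus a → ℝ) (c : ℝ) (v : E (n + 1)) (q : Torus a × ℝ) : ℝ :=
  ⨆ s : ℚ, {p : (Torus a × ℝ) × E (n + 1) | Free F c p.2 p.1 s}.indicator (fun _ => (s : ℝ)) (q, v)

/-- The point where the motion from `q` with velocity `v` leaves the region. -/
def land (F : Torus a → ℝ) (c : ℝ) (v : E (n + 1)) (q : Torus a × ℝ) : Torus a × ℝ :=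
  move v (exitTime F c v q) q

/-- The time at which a uniform motion of velocity `v` crossing the plane at time `0` is at `q`. -/
def baseTime (c : ℝ) (v : E (n + 1)) (q : Torus a × ℝ) : ℝ := (q.2 - c) / v (Fin.last n)

/-- The projection to the plane of height `c` in the direction `v`. -/
def proj (c : ℝ) (v : E (n + 1)) (q : Torus a × ℝ) : Torus a :=
  q.1 + toTorus a (-baseTime c v q • horiz v)

theorem horiz_neg (v : E (n + 1)) : horiz (-v) = -horiz v := rfl

theorem move_zero (v : E (n + 1)) (q : Torus a × ℝ) : move v 0 q = q := by
  simp [move, toTorus_zero]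

theorem move_move (v : E (n + 1)) (r s : ℝ) (q : Torus a × ℝ) :
    move v r (move v s q) = move v (s + r) q := by
  simp only [move, add_smul, toTorus_add, add_mul, add_assoc]

theorem move_neg (v : E (n + 1)) (r : ℝ) (q : Torus a × ℝ) : move (-v) r q = move v (-r) q := by
  simp [move, horiz_neg]

theorem flux_neg (F : Torus a → ℝ) (c : ℝ) (v : E (n + 1)) (q : Torus a × ℝ) :
    flux F c (-v) q = -flux F c v q := by
  unfold flux vertSpeed
  split_ifs
  · simp
  · simp [horiz_neg, inner_neg_right]; ring

theorem baseTime_neg (c : ℝ) (v : E (n + 1)) (q : Torus a × ℝ) :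
    baseTime c (-v) q = -baseTime c v q := by
  simp [baseTime, div_neg]

theorem proj_neg (c : ℝ) (v : E (n + 1)) : proj (a := a) c (-v) = proj c v := by
  funext q
  simp [proj, baseTime_neg, horiz_neg]

theorem baseTime_move (c : ℝ) {v : E (n + 1)} (hv : v (Fin.last n) ≠ 0) (r : ℝ)
    (q : Torus a × ℝ) : baseTime c v (move v r q) = baseTime c v q + r := by
  simp only [baseTime, move]
  field_simp
  ring

theorem proj_move (c : ℝ) {v : E (n + 1)} (hv : v (Fin.last n) ≠ 0) (r : ℝ)
    (q : Torus a × ℝ) : proj c v (move v r q) = proj c v q := by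
  unfold proj
  rw [baseTime_move c hv]
  simp only [move, add_assoc]
  rw [← toTorus_add, ← add_smul]
  congr 3
  ring

theorem move_proj (c : ℝ) {v : E (n + 1)} (hv : v (Fin.last n) ≠ 0) (q : Torus a × ℝ) :
    move v (baseTime c v q) (proj c v q, c) = q := by
  ext1
  · simp only [move, proj, add_assoc]
    rw [← toTorus_add, ← add_smul]
    simp [toTorus_zero]
  · simp only [move, baseTime]
    field_simp
    ring

theorem eq_move_of_proj_eq {c : ℝ} {v : E (n + 1)} (hv : v (Fin.last n) ≠ 0)
    {q q' : Torus a × ℝ} (h : proj c v q = proj c v q') :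
    q' = move v (baseTime c v q' - baseTime c v q) q := by
  conv_lhs => rw [← move_proj c hv q', ← h]
  conv_rhs => rw [← move_proj c hv q, move_move]
  rw [move_proj c hv q]
  congr 1
  ring

theorem continuous_move : Continuous fun p : ((Torus a × ℝ) × E (n + 1)) × ℝ =>
    move p.1.2 p.2 p.1.1 := by
  have h1 := continuous_toTorus (a := a)
  have h2 := continuous_horiz (n := n)
  unfold move
  fun_prop

theorem continuous_move_right (v : E (n + 1)) (q : Torus a × ℝ) :
    Continuous fun r => move v r q :=
  continuous_move.comp (by fun_prop : Continuous fun r : ℝ => ((q, v), r))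

theorem isOpen_region {F : Torus a → ℝ} (hF : Continuous F) (c : ℝ) : IsOpen (region F c) :=
  (isOpen_lt (hF.comp continuous_fst) continuous_snd).inter
    (isOpen_lt continuous_snd continuous_const)

theorem wall_disjoint_region {F : Torus a → ℝ} {c : ℝ} {q : Torus a × ℝ} (h : q ∈ wall F c) :
    q ∉ region F c := by
  rintro ⟨h1, h2⟩
  rcases h with h | h
  · exact h2.ne h
  · exact h1.ne' h

theorem smoothWall_subset_wall {F : Torus a → ℝ} {c : ℝ} : smoothWall F c ⊆ wall F c :=
  fun _ h => h.imp_right And.left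

theorem measurableSet_smoothWall {F : Torus a → ℝ} (hF : Continuous F) (c : ℝ) :
    MeasurableSet (smoothWall F c) := by
  refine (measurableSet_eq_fun measurable_snd measurable_const).union
    ((measurableSet_eq_fun measurable_snd (hF.measurable.comp measurable_fst)).inter
      (measurable_fst (measurableSet_diffPts hF)))

theorem measurable_flux {F : Torus a → ℝ} (hF : Continuous F) (c : ℝ) :
    Measurable fun p : (Torus a × ℝ) × E (n + 1) => flux F c p.2 p.1 := by
  unfold flux
  refine Measurable.ite ?_ ?_ ?_
  · exact measurableSet_eq_fun (measurable_snd.comp measurable_fst) measurable_const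
  · exact Measurable.neg ((Continuous.measurable (by fun_prop) :
      Measurable fun v : E (n + 1) => v (Fin.last n)).comp measurable_snd)
  · exact (measurable_vertSpeed hF).comp
      ((measurable_fst.comp measurable_fst).prodMk measurable_snd)

/-- Over a compact time interval, staying in the open region is an open condition on the initial
data; the open interval `(0, s)` is exhausted by countably many compact ones. -/
theorem measurableSet_free {F : Torus a → ℝ} (hF : Continuous F) (c s : ℝ) :
    MeasurableSet {p : (Torus a × ℝ) × E (n + 1) | Free F c p.2 p.1 s} := by
  have : {p : (Torus a × ℝ) × E (n + 1) | Free F c p.2 p.1 s} =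
      ⋂ k : ℕ, {p | ∀ r ∈ Icc (1 / ((k : ℝ) + 1)) (s - 1 / ((k : ℝ) + 1)),
        move p.2 r p.1 ∈ region F c} := by
    ext p
    simp only [mem_iInter]
    constructor
    · intro h k r hr
      have : 0 < 1 / ((k : ℝ) + 1) := by positivity
      exact h r (by linarith [hr.1]) (by linarith [hr.2])
    · intro h r h0 hs
      obtain ⟨k, hk⟩ := exists_nat_one_div_lt (lt_min h0 (sub_pos.2 hs))
      have h1 := hk.trans_le (min_le_left _ _)
      have h2 := hk.trans_le (min_le_right _ _)
      exact h k r ⟨h1.le, by linarith⟩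
  rw [this]
  refine MeasurableSet.iInter fun k => IsOpen.measurableSet ?_
  refine isOpen_iff_eventually.2 fun p hp => ?_
  refine isCompact_Icc.eventually_forall_of_forall_eventually fun r hr => ?_
  exact continuous_move.continuousAt.eventually ((isOpen_region hF c).mem_nhds (hp r hr))

/-- The definition by a supremum over rational times serves this purpose: it is countable, and each
term is the indicator of a measurable set. -/
theorem measurable_exitTime {F : Torus a → ℝ} (hF : Continuous F) (c : ℝ) :
    Measurable fun p : (Torus a × ℝ) × E (n + 1) => exitTime F c p.2 p.1 := by
  unfold exitTime
  exact Measurable.iSup fun s => measurable_const.indicator (measurableSet_free hF c s)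

theorem measurable_land {F : Torus a → ℝ} (hF : Continuous F) (c : ℝ) :
    Measurable fun p : (Torus a × ℝ) × E (n + 1) => land F c p.2 p.1 :=
  continuous_move.measurable.comp (measurable_id.prodMk (measurable_exitTime hF c))

theorem Free.mono {F : Torus a → ℝ} {c : ℝ} {v : E (n + 1)} {q : Torus a × ℝ} {s t : ℝ}
    (h : Free F c v q t) (hst : s ≤ t) : Free F c v q s :=
  fun r h0 hr => h r h0 (hr.trans_le hst)

theorem exitTime_eq {F : Torus a → ℝ} {c : ℝ} {v : E (n + 1)} {q : Torus a × ℝ} {t : ℝ}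
    (h0 : 0 < t) (h : Free F c v q t) (hw : move v t q ∉ region F c) : exitTime F c v q = t := by
  have key : ∀ s : ℝ, Free F c v q s → s ≤ t := fun s hs => by
    by_contra! hlt
    exact hw (hs t h0 hlt)
  unfold exitTime
  refine ciSup_eq_of_forall_le_of_forall_lt_exists_gt (fun s => ?_) fun w hwt => ?_
  -- At times up to which the motion is not free the indicator is `0`, which stays below the bound
  -- because `0 < t`.
  · refine indicator_apply_le' (fun hs => key s hs) fun _ => h0.le
  · obtain ⟨s, hs1, hs2⟩ := exists_rat_btwn hwt
    refine ⟨s, ?_⟩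
    rw [indicator_of_mem]
    · exact hs1
    · exact h.mono hs2.le

theorem hasDerivAt_height {F : Torus a → ℝ} {x : Torus a} (hx : x ∈ diffPts F) (z : ℝ)
    (v : E (n + 1)) :
    HasDerivAt (fun r : ℝ => (z + r * v (Fin.last n)) - F (x + toTorus a (r • horiz v)))
      (vertSpeed F v x) 0 := by
  have h1 : HasDerivAt (fun r : ℝ => r • horiz v) (horiz v) 0 := by
    simpa using (hasDerivAt_id (0 : ℝ)).smul_const (horiz v)
  have h2 : HasFDerivAt (chart F x) (fderiv ℝ (chart F x) 0) ((0 : ℝ) • horiz v) := by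
    rw [zero_smul]
    exact DifferentiableAt.hasFDerivAt hx
  have h3 := h2.comp_hasDerivAt (0 : ℝ) h1
  have h4 : HasDerivAt (fun r : ℝ => z + r * v (Fin.last n)) (v (Fin.last n)) 0 := by
    simpa using ((hasDerivAt_id (0 : ℝ)).mul_const (v (Fin.last n))).const_add z
  have h5 := h4.sub h3
  rw [vertSpeed, inner_grad]
  exact h5

/-- An outgoing motion enters the region, and its backward continuation does not. -/
theorem exists_free_of_mem_outPts {F : Torus a → ℝ} (hF : Continuous F) {c : ℝ}
    (hc : ∀ x, F x < c) {v : E (n + 1)} {q : Torus a × ℝ} (hq : q ∈ outPts F c v) :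
    ∃ ε > 0, Free F c v q ε ∧ ∀ r, 0 < r → r < ε → move v (-r) q ∉ region F c := by
  -- Both claims come from one sign near time `0`: on the lid that of the last velocity component,
  -- on the graph that of the slope of the height above the graph, whose limit `vertSpeed` is
  -- positive.
  suffices h : ∀ᶠ r in nhdsWithin (0 : ℝ) {0}ᶜ,
      (0 < r → move v r q ∈ region F c) ∧ (r < 0 → move v r q ∉ region F c) by
    rw [eventually_nhdsWithin_iff, Metric.eventually_nhds_iff] at h
    obtain ⟨ε, h0, h⟩ := h
    refine ⟨ε, h0, fun r h1 h2 => ?_, fun r h1 h2 => ?_⟩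
    · exact (h (y := r) (by simpa [abs_of_pos h1] using h2) (by simpa using h1.ne')).1 h1
    · exact (h (y := -r) (by simpa [abs_of_pos h1] using h2) (by simpa using h1.ne')).2 (by linarith)
  have hm : Filter.Tendsto (fun r => move v r q) (nhdsWithin (0 : ℝ) {0}ᶜ) (nhds q) := by
    have := (continuous_move_right v q).tendsto 0
    rw [move_zero] at this
    exact this.mono_left nhdsWithin_le_nhds
  obtain ⟨hw, hfl⟩ := hq
  by_cases hqc : q.2 = c
  · rw [flux, if_pos hqc] at hfl
    have h1 : ∀ᶠ p in nhds q, F p.1 < p.2 :=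
      (isOpen_lt (by fun_prop) (by fun_prop)).mem_nhds (show F q.1 < q.2 from hqc ▸ hc q.1)
    filter_upwards [hm.eventually h1] with r hr
    refine ⟨fun h => ⟨hr, ?_⟩, fun h hreg => ?_⟩
    · simp only [move, hqc]
      nlinarith
    · have := hreg.2
      simp only [move, hqc] at this
      nlinarith
  · rw [flux, if_neg hqc] at hfl
    obtain ⟨hqF, hqd⟩ := hw.resolve_left hqc
    have h1 : ∀ᶠ p in nhds q, p.2 < c :=
      (isOpen_lt continuous_snd continuous_const).mem_nhds (show q.2 < c from hqF ▸ hc q.1)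
    have h2 := (hasDerivAt_iff_tendsto_slope.1 (hasDerivAt_height hqd q.2 v)).eventually_const_lt hfl
    filter_upwards [hm.eventually h1, h2] with r hr hs
    rw [slope_def_field] at hs
    simp only [zero_smul, toTorus_zero, add_zero, zero_mul, hqF, sub_self, sub_zero] at hs
    refine ⟨fun h => ⟨?_, hr⟩, fun h hreg => ?_⟩
    · have := (div_pos_iff_of_pos_right h).1 hs
      simp only [move, hqF]
      linarith
    · have h3 := hreg.1
      simp only [move, hqF] at h3
      rcases div_pos_iff.1 hs with h4 | h4 <;> linarith [h4.1, h4.2]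

/-- A non-horizontal motion crosses the slab between the minimum of `F` and `c` in bounded time, so
the free times have a supremum. The point reached then is in the closed region by continuity, and
not in the open one, since otherwise the flight could be prolonged. -/
theorem exists_exit [∀ i, Fact (0 < a i)] {F : Torus a → ℝ} (hF : Continuous F) {c : ℝ}
    (hc : ∀ x, F x < c) {v : E (n + 1)} (hv : v (Fin.last n) ≠ 0) {q : Torus a × ℝ}
    (hq : q ∈ outPts F c v) :
    ∃ t, 0 < t ∧ Free F c v q t ∧ move v t q ∈ wall F c := by
  obtain ⟨ε, hε, hfree, -⟩ := exists_free_of_mem_outPts hF hc hq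
  obtain ⟨x₀, -, hx₀⟩ := isCompact_univ.exists_isMinOn univ_nonempty hF.continuousOn
  have hmin : ∀ x, F x₀ ≤ F x := fun x => hx₀ (mem_univ x)
  have hq2 : F x₀ ≤ q.2 ∧ q.2 ≤ c := by
    rcases smoothWall_subset_wall hq.1 with h | h
    · exact ⟨h ▸ (hc x₀).le, h.le⟩
    · exact ⟨h ▸ hmin _, h ▸ (hc _).le⟩
  have hbdd : ∀ s, Free F c v q s → s ≤ (c - F x₀) / |v (Fin.last n)| := by
    intro s hs
    by_contra! hlt
    have hpos : 0 < (c - F x₀) / |v (Fin.last n)| :=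
      div_pos (sub_pos.2 (hc x₀)) (abs_pos.2 hv)
    have := hs _ hpos hlt
    have h1 := this.1.trans_le' (hmin _)
    have h2 := this.2
    simp only [move] at h1 h2
    rcases lt_or_gt_of_ne hv with h | h
    · rw [abs_of_neg h, div_mul_eq_mul_div, div_neg, mul_div_cancel_right₀ _ hv] at h1
      linarith
    · rw [abs_of_pos h, div_mul_cancel₀ _ hv] at h2
      linarith
  have hne : {s | Free F c v q s}.Nonempty := ⟨ε, hfree⟩
  have hba : BddAbove {s | Free F c v q s} := ⟨_, fun s hs => hbdd s hs⟩
  set t := sSup {s | Free F c v q s} with ht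
  have hεt : ε ≤ t := le_csSup hba hfree
  have ht0 : 0 < t := hε.trans_le hεt
  have htf : Free F c v q t := by
    intro r h0 hr
    obtain ⟨s, hs, hrs⟩ := exists_lt_of_lt_csSup hne hr
    exact hs r h0 hrs
  refine ⟨t, ht0, htf, ?_⟩
  have hcl : move v t q ∈ {p : Torus a × ℝ | F p.1 ≤ p.2 ∧ p.2 ≤ c} := by
    have hclosed : IsClosed {p : Torus a × ℝ | F p.1 ≤ p.2 ∧ p.2 ≤ c} :=
      (isClosed_le (hF.comp continuous_fst) continuous_snd).inter
        (isClosed_le continuous_snd continuous_const)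
    have htend : Filter.Tendsto (fun r => move v r q) (nhdsWithin t (Iio t)) (nhds (move v t q)) :=
      ((continuous_move_right v q).tendsto t).mono_left nhdsWithin_le_nhds
    refine hclosed.mem_of_tendsto htend ?_
    filter_upwards [Ioo_mem_nhdsLT ht0] with r hr
    exact ⟨(htf r hr.1 hr.2).1.le, (htf r hr.1 hr.2).2.le⟩
  have hnr : move v t q ∉ region F c := by
    intro hreg
    have := (continuous_move_right v q).continuousAt.eventually ((isOpen_region hF c).mem_nhds hreg)
    obtain ⟨δ, hδ, h⟩ := Metric.eventually_nhds_iff.1 this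
    have : Free F c v q (t + δ) := by
      intro r h0 hr
      rcases lt_or_ge r t with h1 | h1
      · exact htf r h0 h1
      · exact h (by rw [Real.dist_eq, abs_of_nonneg] <;> linarith)
    linarith [le_csSup hba this]
  rcases hcl.1.lt_or_eq with h1 | h1
  · rcases hcl.2.lt_or_eq with h2 | h2
    · exact absurd ⟨h1, h2⟩ hnr
    · exact Or.inl h2
  · exact Or.inr h1.symm

theorem land_spec [∀ i, Fact (0 < a i)] {F : Torus a → ℝ} (hF : Continuous F) {c : ℝ}
    (hc : ∀ x, F x < c) {v : E (n + 1)} (hv : v (Fin.last n) ≠ 0) {q : Torus a × ℝ}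
    (hq : q ∈ outPts F c v) :
    0 < exitTime F c v q ∧ Free F c v q (exitTime F c v q) ∧ land F c v q ∈ wall F c := by
  obtain ⟨t, h0, hf, hw⟩ := exists_exit hF hc hv hq
  have := exitTime_eq h0 hf (wall_disjoint_region hw)
  unfold land
  rw [this]
  exact ⟨h0, hf, hw⟩

/-- Running the motion backwards from the exit point leads back to the starting point. -/
theorem land_neg_land [∀ i, Fact (0 < a i)] {F : Torus a → ℝ} (hF : Continuous F) {c : ℝ}
    (hc : ∀ x, F x < c) {v : E (n + 1)} (hv : v (Fin.last n) ≠ 0) {q : Torus a × ℝ}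
    (hq : q ∈ outPts F c v) : land F c (-v) (land F c v q) = q := by
  obtain ⟨h0, hf, hw⟩ := land_spec hF hc hv hq
  have hback : ∀ r, move (-v) r (land F c v q) = move v (exitTime F c v q - r) q := by
    intro r
    rw [land, move_neg, move_move, sub_eq_add_neg]
  have hend : move (-v) (exitTime F c v q) (land F c v q) = q := by
    rw [hback, sub_self, move_zero]
  have : exitTime F c (-v) (land F c v q) = exitTime F c v q := by
    refine exitTime_eq h0 (fun r h1 h2 => ?_) ?_
    · rw [hback]
      exact hf _ (by linarith) (by linarith)
    · rw [hend]
      exact wall_disjoint_region (smoothWall_subset_wall hq.1)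
  rw [land, this, hend]

/-- Just before landing the motion is inside the region, whereas backwards from an outgoing point it
is outside. A smooth transversal landing point is therefore outgoing for `-v`. -/
theorem land_not_mem_outPts [∀ i, Fact (0 < a i)] {F : Torus a → ℝ} (hF : Continuous F) {c : ℝ}
    (hc : ∀ x, F x < c) {v : E (n + 1)} (hv : v (Fin.last n) ≠ 0) {q : Torus a × ℝ}
    (hq : q ∈ outPts F c v) : land F c v q ∉ outPts F c v := by
  intro h
  obtain ⟨h0, hf, hw⟩ := land_spec hF hc hv hq
  obtain ⟨ε, hε, -, hb⟩ := exists_free_of_mem_outPts hF hc h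
  obtain ⟨r, hr0, hr⟩ := exists_between (lt_min hε h0)
  refine hb r hr0 (hr.trans_le (min_le_left _ _)) ?_
  rw [land, move_move]
  have := hr.trans_le (min_le_right _ _)
  exact hf _ (by linarith) (by linarith)

end

/-! ### Free flight carries the flux of `v` to the flux of `-v`. -/

section

variable {n : ℕ} {a : Fin n → ℝ}

theorem measurable_flux_right {F : Torus a → ℝ} (hF : Continuous F) (c : ℝ) (v : E (n + 1)) :
    Measurable fun q => flux F c v q :=
  (measurable_flux hF c).comp (measurable_id.prodMk measurable_const)

theorem measurableSet_outPts {F : Torus a → ℝ} (hF : Continuous F) (c : ℝ) (v : E (n + 1)) :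
    MeasurableSet (outPts F c v) :=
  (measurableSet_smoothWall hF c).inter
    (measurableSet_lt measurable_const (measurable_flux_right hF c v))

theorem measurable_land_right {F : Torus a → ℝ} (hF : Continuous F) (c : ℝ) (v : E (n + 1)) :
    Measurable (land F c v) :=
  Measurable.comp (g := fun p : (Torus a × ℝ) × E (n + 1) => land F c p.2 p.1)
    (f := fun q => (q, v)) (measurable_land hF c) (measurable_id.prodMk measurable_const)

theorem continuous_baseTime (c : ℝ) (v : E (n + 1)) : Continuous (baseTime (a := a) c v) := by
  unfold baseTime
  fun_prop

theorem continuous_proj (c : ℝ) (v : E (n + 1)) : Continuous (proj (a := a) c v) := by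
  have h1 := continuous_toTorus (a := a)
  have h2 := continuous_baseTime (a := a) c v
  unfold proj
  fun_prop

theorem proj_graph (F : Torus a → ℝ) (c : ℝ) (v : E (n + 1)) (x : Torus a) :
    proj c v (x, F x) = slide F c v x := by
  simp only [proj, slide, baseTime, ← neg_div, neg_sub]

theorem proj_plane (c : ℝ) (v : E (n + 1)) (x : Torus a) : proj c v (x, c) = x := by
  simp [proj, baseTime, toTorus_zero]

/-- A piece of the outgoing boundary on which the projection along `v` is injective. -/
def piece (F : Torus a → ℝ) (c : ℝ) (v : E (n + 1)) (i : ℕ × ℤ) : Set (Torus a × ℝ) :=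
  {q | q ∈ outPts F c v ∧ Free F c v q (1 / ((i.1 : ℝ) + 1)) ∧
    i.2 ≤ ((i.1 : ℝ) + 1) * baseTime c v q ∧ ((i.1 : ℝ) + 1) * baseTime c v q < i.2 + 1}

theorem measurableSet_piece {F : Torus a → ℝ} (hF : Continuous F) (c : ℝ) (v : E (n + 1))
    (i : ℕ × ℤ) : MeasurableSet (piece F c v i) := by
  have h := (continuous_baseTime (a := a) c v).measurable.const_mul ((i.1 : ℝ) + 1)
  refine (measurableSet_outPts hF c v).inter (MeasurableSet.inter ?_
    ((measurableSet_le measurable_const h).inter (measurableSet_lt h measurable_const)))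
  exact (measurableSet_free hF c _).preimage
    (measurable_id.prodMk measurable_const : Measurable fun q : Torus a × ℝ => (q, v))

theorem outPts_subset_iUnion_piece {F : Torus a → ℝ} (hF : Continuous F) {c : ℝ}
    (hc : ∀ x, F x < c) (v : E (n + 1)) : outPts F c v ⊆ ⋃ i, piece F c v i := by
  intro q hq
  obtain ⟨ε, hε, hf, -⟩ := exists_free_of_mem_outPts hF hc hq
  obtain ⟨k, hk⟩ := exists_nat_one_div_lt hε
  exact mem_iUnion.2 ⟨(k, ⌊((k : ℝ) + 1) * baseTime c v q⌋), hq, hf.mono hk.le,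
    Int.floor_le _, Int.lt_floor_add_one _⟩

/-- Two points with the same shadow lie on one line, and on a piece their times differ by less than
the guaranteed free time. The later one would thus be interior to the region, yet it is on the wall.
-/
theorem injOn_proj_piece (F : Torus a → ℝ) (c : ℝ) {v : E (n + 1)} (hv : v (Fin.last n) ≠ 0)
    (i : ℕ × ℤ) : InjOn (proj c v) (piece F c v i) := by
  have key : ∀ q ∈ piece F c v i, ∀ q' ∈ piece F c v i, proj c v q = proj c v q' →
      ¬ baseTime c v q < baseTime c v q' := by
    intro q hq q' hq' h hlt
    refine wall_disjoint_region (smoothWall_subset_wall hq'.1.1) ?_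
    rw [eq_move_of_proj_eq hv h]
    refine hq.2.1 _ (sub_pos.2 hlt) ?_
    have hk : (0 : ℝ) < (i.1 : ℝ) + 1 := by positivity
    rw [lt_div_iff₀ hk]
    have h1 := hq.2.2.1
    have h2 := hq'.2.2.2
    nlinarith
  intro q hq q' hq' h
  have h1 := key q hq q' hq' h
  have h2 := key q' hq' q hq h.symm
  have h3 : baseTime c v q = baseTime c v q' := le_antisymm (not_lt.1 h2) (not_lt.1 h1)
  rw [eq_move_of_proj_eq hv h, h3, sub_self, move_zero]

variable [∀ i, Fact (0 < a i)]

/-- The horizontal area measure on the boundary of the region. -/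
def wallMeasure (F : Torus a → ℝ) (c : ℝ) : Measure (Torus a × ℝ) :=
  (uniform a).map (fun x => (x, F x)) + (uniform a).map (fun x => (x, c))

/-- The measure `|⟨v, normal⟩| dA` on the boundary points where `v` points into the region. -/
def outMeasure (F : Torus a → ℝ) (c : ℝ) (v : E (n + 1)) : Measure (Torus a × ℝ) :=
  (wallMeasure F c).withDensity fun q => ENNReal.ofReal (flux F c v q)

theorem lintegral_wallMeasure {F : Torus a → ℝ} (hF : Continuous F) (c : ℝ)
    {g : Torus a × ℝ → ENNReal} (hg : Measurable g) :
    ∫⁻ q, g q ∂(wallMeasure F c) =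
      ∫⁻ x, g (x, F x) ∂(uniform a) + ∫⁻ x, g (x, c) ∂(uniform a) := by
  have h1 : Measurable fun x => (x, F x) := measurable_id.prodMk hF.measurable
  have h2 : Measurable fun x : Torus a => (x, c) := measurable_id.prodMk measurable_const
  rw [wallMeasure, lintegral_add_measure, lintegral_map hg h1, lintegral_map hg h2]

theorem IsPiecewiseSmooth.wallMeasure_compl_smoothWall {F : Torus a → ℝ}
    (hF : IsPiecewiseSmooth F) (c : ℝ) : wallMeasure F c (smoothWall F c)ᶜ = 0 := by
  have hm := (measurableSet_smoothWall hF.continuous c).compl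
  have h1 : Measurable fun x => (x, F x) := measurable_id.prodMk hF.continuous.measurable
  have h2 : Measurable fun x : Torus a => (x, c) := measurable_id.prodMk measurable_const
  rw [wallMeasure, Measure.add_apply, Measure.map_apply h1 hm, Measure.map_apply h2 hm]
  have e1 : uniform a ((fun x => (x, F x)) ⁻¹' (smoothWall F c)ᶜ) = 0 := by
    refine measure_mono_null (fun x hx => ?_) hF.uniform_compl_diffPts
    exact fun hd => hx (Or.inr ⟨rfl, hd⟩)
  have e2 : (fun x : Torus a => (x, c)) ⁻¹' (smoothWall F c)ᶜ = ∅ := by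
    ext x
    simp only [mem_preimage, mem_compl_iff, mem_empty_iff_false, iff_false, not_not]
    exact Or.inl rfl
  rw [e1, e2, measure_empty, add_zero]

theorem IsPiecewiseSmooth.outMeasure_compl_outPts {F : Torus a → ℝ}
    (hF : IsPiecewiseSmooth F) (c : ℝ) (v : E (n + 1)) :
    outMeasure F c v (outPts F c v)ᶜ = 0 := by
  rw [outMeasure, withDensity_apply _ (measurableSet_outPts hF.continuous c v).compl,
    setLIntegral_eq_zero_iff (measurableSet_outPts hF.continuous c v).compl
      (measurable_flux_right hF.continuous c v).ennreal_ofReal]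
  have : ∀ᵐ q ∂(wallMeasure F c), q ∈ smoothWall F c :=
    ae_iff.2 (hF.wallMeasure_compl_smoothWall c)
  filter_upwards [this] with q hq hq2
  refine ENNReal.ofReal_of_nonpos ?_
  by_contra! h
  exact hq2 ⟨hq, h⟩

/-- The flux through a set of boundary points is the area of its projection. -/
theorem outMeasure_eq_proj_image {F : Torus a → ℝ} (hF : Continuous F) {c : ℝ}
    (hc : ∀ x, F x < c) {v : E (n + 1)} (hv : v (Fin.last n) ≠ 0) {A : Set (Torus a × ℝ)}
    (hA : MeasurableSet A) (hAo : A ⊆ outPts F c v) (hinj : InjOn (proj c v) A) :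
    outMeasure F c v A = ENNReal.ofReal |v (Fin.last n)| * uniform a (proj c v '' A) := by
  have hm1 : Measurable fun x => (x, F x) := measurable_id.prodMk hF.measurable
  have hm2 : Measurable fun x : Torus a => (x, c) := measurable_id.prodMk measurable_const
  set A₁ := (fun x => (x, F x)) ⁻¹' A with hA₁
  set A₂ := (fun x : Torus a => (x, c)) ⁻¹' A with hA₂
  have himg : proj c v '' A = slide F c v '' A₁ ∪ A₂ := by
    ext y
    constructor
    · rintro ⟨⟨x, z⟩, hq, rfl⟩
      rcases smoothWall_subset_wall (hAo hq).1 with h | h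
      · obtain rfl : z = c := h
        exact Or.inr (by rw [proj_plane]; exact hq)
      · obtain rfl : z = F x := h
        exact Or.inl ⟨x, hq, (proj_graph F c v x).symm⟩
    · rintro (⟨x, hx, rfl⟩ | hy)
      · exact ⟨_, hx, proj_graph F c v x⟩
      · exact ⟨_, hy, proj_plane c v y⟩
  have hdisj : Disjoint (slide F c v '' A₁) A₂ := by
    refine Set.disjoint_left.2 ?_
    rintro _ ⟨x, hx, rfl⟩ hy
    have := hinj hx hy (by rw [proj_graph, proj_plane])
    exact (hc x).ne (congrArg Prod.snd this)
  have hsub : A₁ ⊆ diffPts F := by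
    intro x hx
    rcases (hAo hx).1 with h | h
    · exact absurd h (hc x).ne
    · exact h.2
  have hfl : ∀ x, flux F c v (x, F x) = vertSpeed F v x := fun x => if_neg (hc x).ne
  have hfl2 : ∀ x : Torus a, flux F c v (x, c) = -v (Fin.last n) := fun x => if_pos rfl
  have hinj1 : InjOn (slide F c v) A₁ := by
    intro x hx y hy h
    rw [← proj_graph, ← proj_graph] at h
    exact congrArg Prod.fst (hinj hx hy h)
  -- The graph part is the change of variables for `slide`; on the lid the projection is the
  -- identity and the outgoing flux is the constant `|v_last|`.
  rw [outMeasure, withDensity_apply _ hA, ← lintegral_indicator hA, lintegral_wallMeasure hF c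
    ((measurable_flux_right hF c v).ennreal_ofReal.indicator hA), himg,
    measure_union hdisj (hm2 hA), mul_add, ← lintegral_abs_vertSpeed hF c hv (hm1 hA) hsub hinj1,
    ← lintegral_indicator (hm1 hA)]
  congr 1
  · refine lintegral_congr fun x => ?_
    by_cases hx : x ∈ A₁
    · rw [indicator_of_mem (show (x, F x) ∈ A from hx), indicator_of_mem hx, hfl, abs_of_pos]
      rw [← hfl]
      exact (hAo hx).2
    · rw [indicator_of_notMem (show (x, F x) ∉ A from hx), indicator_of_notMem hx]
  · rw [← setLIntegral_const, ← lintegral_indicator (hm2 hA)]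
    refine lintegral_congr fun x => ?_
    by_cases hx : x ∈ A₂
    · rw [indicator_of_mem (show (x, c) ∈ A from hx), indicator_of_mem hx]
      have := (hAo (show (x, c) ∈ A from hx)).2
      rw [hfl2] at this ⊢
      rw [abs_of_neg (by linarith)]
    · rw [indicator_of_notMem (show (x, c) ∉ A from hx), indicator_of_notMem hx]

/-- The area formula holds on each of the countably many pieces where the projection is injective;
points that are not outgoing carry no mass. -/
theorem IsPiecewiseSmooth.outMeasure_proj_preimage_null {F : Torus a → ℝ}
    (hF : IsPiecewiseSmooth F) {c : ℝ} (hc : ∀ x, F x < c) {v : E (n + 1)}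
    (hv : v (Fin.last n) ≠ 0) {N : Set (Torus a)} (hN : MeasurableSet N) (h0 : uniform a N = 0) :
    outMeasure F c v (proj c v ⁻¹' N) = 0 := by
  have hsub : proj c v ⁻¹' N ⊆
      (⋃ i, piece F c v i ∩ proj c v ⁻¹' N) ∪ (outPts F c v)ᶜ := by
    intro q hq
    by_cases h : q ∈ outPts F c v
    · obtain ⟨i, hi⟩ := mem_iUnion.1 (outPts_subset_iUnion_piece hF.continuous hc v h)
      exact Or.inl (mem_iUnion.2 ⟨i, hi, hq⟩)
    · exact Or.inr h
  refine measure_mono_null hsub (measure_union_null (measure_iUnion_null fun i => ?_)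
    (hF.outMeasure_compl_outPts c v))
  rw [outMeasure_eq_proj_image hF.continuous hc hv
    ((measurableSet_piece hF.continuous c v i).inter ((continuous_proj c v).measurable hN))
    (fun q hq => hq.1.1) ((injOn_proj_piece F c hv i).mono inter_subset_left)]
  rw [measure_mono_null _ h0, mul_zero]
  rintro _ ⟨q, hq, rfl⟩
  exact hq.2

/-- `N` contains the shadows of all non-smooth and all grazing points, so a line with its base point
off `N` meets the wall only transversally and at smooth points. -/
theorem IsPiecewiseSmooth.exists_null_superset {F : Torus a → ℝ}
    (hF : IsPiecewiseSmooth F) {c : ℝ} (hc : ∀ x, F x < c) {v : E (n + 1)}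
    (hv : v (Fin.last n) ≠ 0) :
    ∃ N : Set (Torus a), MeasurableSet N ∧ uniform a N = 0 ∧
      ∀ q ∈ wall F c, proj c v q ∉ N → q ∈ outPts F c v ∨ q ∈ outPts F c (-v) := by
  have h0 : uniform a (slide F c v '' (diffPts F)ᶜ ∪
      slide F c v '' {x | x ∈ diffPts F ∧ vertSpeed F v x = 0}) = 0 :=
    measure_union_null (hF.uniform_slide_image_compl_diffPts c v)
      (uniform_slide_image_of_vertSpeed_eq_zero F c hv (fun x hx => hx.1) fun x hx => hx.2)
  obtain ⟨N, hsub, hm, hN⟩ := exists_measurable_superset_of_null h0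
  refine ⟨N, hm, hN, ?_⟩
  rintro ⟨x, z⟩ hq hqN
  have hs : (x, z) ∈ smoothWall F c ∧ flux F c v (x, z) ≠ 0 := by
    by_cases hz : z = c
    · subst hz
      refine ⟨Or.inl rfl, ?_⟩
      rw [flux, if_pos rfl]
      exact neg_ne_zero.2 hv
    · obtain rfl : z = F x := hq.resolve_left hz
      rw [proj_graph] at hqN
      have hd : x ∈ diffPts F := by
        by_contra h
        exact hqN (hsub (Or.inl ⟨x, h, rfl⟩))
      refine ⟨Or.inr ⟨rfl, hd⟩, fun h => hqN (hsub (Or.inr ⟨x, ⟨hd, ?_⟩, rfl⟩))⟩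
      rwa [flux, if_neg hz] at h
  rcases lt_or_gt_of_ne hs.2 with h | h
  · refine Or.inr ⟨hs.1, ?_⟩
    rw [flux_neg]
    linarith
  · exact Or.inl ⟨hs.1, h⟩

/-- The free flight preserves the flux measure. -/
theorem IsPiecewiseSmooth.map_land {F : Torus a → ℝ}
    (hF : IsPiecewiseSmooth F) {c : ℝ} (hc : ∀ x, F x < c) {v : E (n + 1)}
    (hv : v (Fin.last n) ≠ 0) :
    (outMeasure F c v).map (land F c v) = outMeasure F c (-v) := by
  obtain ⟨N, hNm, hN0, hN⟩ := hF.exists_null_superset hc hv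
  have hv' : (-v) (Fin.last n) ≠ 0 := neg_ne_zero.2 hv
  have hcont := hF.continuous
  -- On the lines that avoid `N`, the flights with velocities `v` and `-v` are mutually inverse
  -- bijections between `G` and `G'`.
  set G := outPts F c v ∩ (proj c v ⁻¹' N)ᶜ with hG
  set G' := outPts F c (-v) ∩ (proj c v ⁻¹' N)ᶜ with hG'
  have hNm' := ((continuous_proj (a := a) c v).measurable hNm).compl
  have hGm : MeasurableSet G := (measurableSet_outPts hcont c v).inter hNm'
  have hGm' : MeasurableSet G' := (measurableSet_outPts hcont c (-v)).inter hNm'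
  have hproj : ∀ q, proj c v (land F c v q) = proj c v q := fun q => proj_move c hv _ q
  have hproj' : ∀ q, proj c v (land F c (-v) q) = proj c v q := fun q => by
    rw [← proj_neg]
    exact proj_move c hv' _ q
  have hmaps : ∀ q ∈ G, land F c v q ∈ G' := by
    intro q hq
    have h1 : proj c v (land F c v q) ∉ N := by
      rw [hproj]
      exact hq.2
    refine ⟨?_, h1⟩
    exact (hN _ (land_spec hcont hc hv hq.1).2.2 h1).resolve_left
      (land_not_mem_outPts hcont hc hv hq.1)
  have hmaps' : ∀ q ∈ G', land F c (-v) q ∈ G := by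
    intro q hq
    have h1 : proj c v (land F c (-v) q) ∉ N := by
      rw [hproj']
      exact hq.2
    refine ⟨?_, h1⟩
    exact (hN _ (land_spec hcont hc hv' hq.1).2.2 h1).resolve_right
      (land_not_mem_outPts hcont hc hv' hq.1)
  have hinv : ∀ q ∈ G, land F c (-v) (land F c v q) = q :=
    fun q hq => land_neg_land hcont hc hv hq.1
  have hinv' : ∀ q ∈ G', land F c v (land F c (-v) q) = q := by
    intro q hq
    have := land_neg_land hcont hc hv' hq.1
    rwa [neg_neg] at this
  have hae : ∀ᵐ q ∂(outMeasure F c v), q ∈ G :=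
    measure_mono_null (fun q hq => by
      by_cases h : q ∈ outPts F c v
      · exact Or.inr (by_contra fun h2 => hq ⟨h, h2⟩)
      · exact Or.inl h)
      (measure_union_null (hF.outMeasure_compl_outPts c v)
        (hF.outMeasure_proj_preimage_null hc hv hNm hN0))
  have hae' : ∀ᵐ q ∂(outMeasure F c (-v)), q ∈ G' :=
    measure_mono_null (fun q hq => by
      by_cases h : q ∈ outPts F c (-v)
      · refine Or.inr (by_contra fun h2 => hq ⟨h, ?_⟩)
        rwa [proj_neg] at h2
      · exact Or.inl h)
      (measure_union_null (hF.outMeasure_compl_outPts c (-v))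
        (hF.outMeasure_proj_preimage_null hc hv' hNm hN0))
  have hlm := measurable_land_right hcont c v
  have hU : ∀ q ∈ G', q ∈ ⋃ i, piece F c (-v) i :=
    fun q hq => outPts_subset_iUnion_piece hcont hc (-v) hq.1
  have hae1 : ∀ᵐ q ∂((outMeasure F c v).map (land F c v)), q ∈ ⋃ i, piece F c (-v) i := by
    have hm : MeasurableSet (⋃ i, piece F c (-v) i) :=
      MeasurableSet.iUnion fun i => measurableSet_piece hcont c (-v) i
    refine (ae_map_iff (p := fun q => q ∈ ⋃ i, piece F c (-v) i) hlm.aemeasurable hm).2 ?_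
    filter_upwards [hae] with q hq using hU _ (hmaps q hq)
  -- It suffices to compare the two measures on each piece of the target, where the projection is
  -- injective and the area formula applies.
  rw [← Measure.restrict_eq_self_of_ae_mem hae1,
    ← Measure.restrict_eq_self_of_ae_mem (hae'.mono hU), Measure.restrict_iUnion_congr]
  intro i
  have hpm := measurableSet_piece hcont c (-v) i
  ext B hB
  rw [Measure.restrict_apply hB, Measure.restrict_apply hB, Measure.map_apply hlm (hB.inter hpm)]
  set D := B ∩ piece F c (-v) i ∩ G' with hD
  have hDm : MeasurableSet D := (hB.inter hpm).inter hGm'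
  have hinjD : InjOn (proj c v) D := by
    rw [← proj_neg]
    exact (injOn_proj_piece F c hv' i).mono fun q hq => hq.1.2
  have e1 : outMeasure F c (-v) (B ∩ piece F c (-v) i) = outMeasure F c (-v) D :=
    (measure_inter_conull' (measure_mono_null (fun q hq => hq.2) hae')).symm
  have e2 : outMeasure F c v (land F c v ⁻¹' (B ∩ piece F c (-v) i)) =
      outMeasure F c v (G ∩ land F c v ⁻¹' D) := by
    refine measure_congr ?_
    filter_upwards [hae] with q hq
    refine propext ?_
    exact ⟨fun h => ⟨hq, h, hmaps q hq⟩, fun h => h.2.1⟩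
  -- The heart of the matter: a set and its preimage under the flight have the same shadow, hence
  -- the same flux.
  have himg : proj c v '' (G ∩ land F c v ⁻¹' D) = proj c v '' D := by
    ext y
    constructor
    · rintro ⟨q, hq, rfl⟩
      exact ⟨_, hq.2, hproj q⟩
    · rintro ⟨q, hq, rfl⟩
      refine ⟨land F c (-v) q, ⟨hmaps' q hq.2, ?_⟩, hproj' q⟩
      rw [mem_preimage, hinv' q hq.2]
      exact hq
  have hinj : InjOn (proj c v) (G ∩ land F c v ⁻¹' D) := by
    intro q hq q' hq' h
    have := hinjD hq.2 hq'.2 (by rw [hproj, hproj, h])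
    rw [← hinv q hq.1, this, hinv q' hq'.1]
  rw [e1, e2, outMeasure_eq_proj_image hcont hc hv (hGm.inter (hlm hDm)) (fun q hq => hq.1.1) hinj,
    outMeasure_eq_proj_image hcont hc hv' hDm (fun q hq => hq.2.1) (by rwa [proj_neg]), himg,
    proj_neg]
  congr 2
  exact (abs_neg _).symm

end

/-! ### Poincaré recurrence and invariance under the first return map. -/

section

/-- The points whose orbit under `T` first returns to `P` at time `k + 1`, at a point of `A`. -/
def returnSet {α : Type*} (T : α → α) (P A : Set α) (k : ℕ) : Set α :=
  {y | (∀ i < k, T^[i + 1] y ∉ P) ∧ T^[k + 1] y ∈ A}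

/-- The points whose orbit under `T` first enters `P` at time `k`, at a point of `A`. -/
def entrySet {α : Type*} (T : α → α) (P A : Set α) (k : ℕ) : Set α :=
  {y | (∀ i < k, T^[i] y ∉ P) ∧ T^[k] y ∈ A}

open Classical in
/-- The first return map of `T` to `P`. -/
def returnMap {α : Type*} (T : α → α) (P : Set α) (y : α) : α :=
  if h : ∃ k, y ∈ returnSet T P P k then T^[Nat.find h + 1] y else y

section Recurrence

variable {α : Type*} {T : α → α} {P A : Set α}

theorem preimage_entrySet (k : ℕ) : T ⁻¹' entrySet T P A k = returnSet T P A k := rfl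

theorem returnSet_diff (k : ℕ) : returnSet T P A k \ P = entrySet T P A (k + 1) := by
  ext y
  constructor
  · rintro ⟨⟨h1, h2⟩, h3⟩
    refine ⟨fun i hi => ?_, h2⟩
    rcases i with _ | i
    · exact h3
    · exact h1 i (by omega)
  · rintro ⟨h1, h2⟩
    exact ⟨⟨fun i hi => h1 (i + 1) (by omega), h2⟩, h1 0 (by omega)⟩

theorem returnSet_eq_of_mem {y : α} {j k : ℕ} (hj : y ∈ returnSet T P P j)
    (hk : y ∈ returnSet T P P k) : j = k := by
  rcases lt_trichotomy j k with h | h | h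
  · exact absurd hj.2 (hk.1 j h)
  · exact h
  · exact absurd hk.2 (hj.1 k h)

theorem returnMap_eq {y : α} {k : ℕ} (h : y ∈ returnSet T P P k) :
    returnMap T P y = T^[k + 1] y := by
  have hex : ∃ k, y ∈ returnSet T P P k := ⟨k, h⟩
  classical
  rw [returnMap, dif_pos hex, returnSet_eq_of_mem (Nat.find_spec hex) h]

theorem pairwise_disjoint_returnSet : Pairwise (Function.onFun Disjoint
    fun k => returnSet T P P k ∩ P) :=
  fun _ _ hjk => Set.disjoint_left.2 fun _ hj hk => hjk (returnSet_eq_of_mem hj.1 hk.1)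

variable [MeasurableSpace α] {μ : Measure α}

theorem measurableSet_entrySet (hT : Measurable T) (hP : MeasurableSet P) (hA : MeasurableSet A)
    (k : ℕ) : MeasurableSet (entrySet T P A k) := by
  have : entrySet T P A k = (⋂ i, ⋂ (_ : i < k), (T^[i] ⁻¹' P)ᶜ) ∩ T^[k] ⁻¹' A := by
    ext y; simp [entrySet]
  rw [this]
  exact (MeasurableSet.iInter fun i => MeasurableSet.iInter fun _ => (hT.iterate i hP).compl).inter
    (hT.iterate k hA)

theorem measurableSet_returnSet (hT : Measurable T) (hP : MeasurableSet P) (hA : MeasurableSet A)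
    (k : ℕ) : MeasurableSet (returnSet T P A k) :=
  hT (measurableSet_entrySet hT hP hA k)

theorem measurable_returnMap (hT : Measurable T) (hP : MeasurableSet P) :
    Measurable (returnMap T P) := by
  intro A hA
  have : returnMap T P ⁻¹' A = (⋃ k, returnSet T P P k ∩ T^[k + 1] ⁻¹' A) ∪
      ((⋃ k, returnSet T P P k)ᶜ ∩ A) := by
    ext y
    by_cases h : ∃ k, y ∈ returnSet T P P k
    · obtain ⟨k, hk⟩ := h
      rw [mem_preimage, returnMap_eq hk]
      constructor
      · exact fun h => Or.inl (mem_iUnion.2 ⟨k, hk, h⟩)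
      · rintro (h | h)
        · obtain ⟨j, hj, hjA⟩ := mem_iUnion.1 h
          rwa [returnSet_eq_of_mem hk hj]
        · exact absurd (mem_iUnion.2 ⟨k, hk⟩) h.1
    · rw [mem_preimage, returnMap, dif_neg h]
      constructor
      · exact fun hA => Or.inr ⟨fun h2 => h (mem_iUnion.1 h2), hA⟩
      · rintro (h2 | h2)
        · obtain ⟨j, hj, -⟩ := mem_iUnion.1 h2
          exact absurd ⟨j, hj⟩ h
        · exact h2.2
  rw [this]
  have hm := measurableSet_returnSet hT hP hP
  exact (MeasurableSet.iUnion fun k => (hm k).inter (hT.iterate _ hA)).union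
    ((MeasurableSet.iUnion hm).compl.inter hA)

/-- The measure of a subset of `P` is the sum of the measures of the parts of `P` returning to it
at the times `1, 2, …`. -/
theorem tsum_measure_returnSet [IsFiniteMeasure μ] (hT : MeasurePreserving T μ μ)
    (hP : MeasurableSet P) (hA : MeasurableSet A) (hAP : A ⊆ P) :
    ∑' k, μ (returnSet T P A k ∩ P) = μ A := by
  -- Invariance replaces an entry set by its preimage, the return set. Its part in `P` is the
  -- summand, and its part outside `P` is the entry set one step later; so the sum telescopes.
  have hstep : ∀ k, μ (entrySet T P A k) =
      μ (returnSet T P A k ∩ P) + μ (entrySet T P A (k + 1)) := by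
    intro k
    rw [← returnSet_diff, measure_inter_add_sdiff _ hP, ← preimage_entrySet,
      hT.measure_preimage (measurableSet_entrySet hT.measurable hP hA k).nullMeasurableSet]
  have hsum : ∀ k, ∑ i ∈ Finset.range k, μ (returnSet T P A i ∩ P) + μ (entrySet T P A k) =
      μ A := by
    intro k
    induction k with
    | zero =>
      have : entrySet T P A 0 = A := by ext y; simp [entrySet]
      simp [this]
    | succ k ih => rw [Finset.sum_range_succ, add_assoc, ← hstep, ih]
  have hd : Pairwise (Function.onFun Disjoint (entrySet T P A)) := by
    have key : ∀ j k, j < k → ∀ y ∈ entrySet T P A j, y ∉ entrySet T P A k :=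
      fun j k hjk y hj hk => hk.1 j hjk (hAP hj.2)
    intro j k hjk
    refine Set.disjoint_left.2 fun y hj hk => ?_
    rcases lt_or_gt_of_ne hjk with h | h
    · exact key j k h y hj hk
    · exact key k j h y hk hj
  -- The entry sets are disjoint in a finite measure space, so the remainder of the telescoping sum
  -- tends to `0`.
  have htop : ∑' k, μ (entrySet T P A k) ≠ ⊤ := by
    rw [← measure_iUnion hd (measurableSet_entrySet hT.measurable hP hA)]
    exact measure_ne_top _ _
  have h1 := ENNReal.tendsto_nat_tsum fun k => μ (returnSet T P A k ∩ P)
  have h2 := h1.add (ENNReal.tendsto_atTop_zero_of_tsum_ne_top htop)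
  simp only [hsum, add_zero] at h2
  exact tendsto_nhds_unique h2 tendsto_const_nhds

/-- Poincaré recurrence. -/
theorem ae_exists_mem_returnSet [IsFiniteMeasure μ] (hT : MeasurePreserving T μ μ)
    (hP : MeasurableSet P) : ∀ᵐ y ∂(μ.restrict P), ∃ k, y ∈ returnSet T P P k := by
  have hm := fun k => (measurableSet_returnSet hT.measurable hP hP k).inter hP
  -- With `A = P` the points that return have the full measure of `P`.
  have h1 := tsum_measure_returnSet hT hP hP subset_rfl
  rw [← measure_iUnion pairwise_disjoint_returnSet hm] at h1
  have hsub : (⋃ k, returnSet T P P k ∩ P) ⊆ P := iUnion_subset fun k => inter_subset_right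
  have h2 := measure_sdiff hsub (MeasurableSet.iUnion hm).nullMeasurableSet (measure_ne_top μ _)
  rw [h1, tsub_self] at h2
  rw [ae_restrict_iff' hP]
  refine measure_mono_null (fun y hy => ?_) h2
  simp only [mem_compl_iff, mem_ofPred_eq, not_forall] at hy
  obtain ⟨hyP, hy⟩ := hy
  refine ⟨hyP, fun h => hy ?_⟩
  obtain ⟨k, hk⟩ := mem_iUnion.1 h
  exact ⟨k, hk.1⟩

/-- The first return map preserves the restriction of the measure. -/
theorem map_returnMap [IsFiniteMeasure μ] (hT : MeasurePreserving T μ μ) (hP : MeasurableSet P) :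
    (μ.restrict P).map (returnMap T P) = μ.restrict P := by
  have hr := measurable_returnMap hT.measurable hP
  have hm := fun k => (measurableSet_returnSet hT.measurable hP hP k).inter hP
  ext A hA
  rw [Measure.map_apply hr hA, Measure.restrict_apply (hr hA), Measure.restrict_apply hA]
  -- Almost every point of `P` returns, so the preimage splits by return time, and
  -- `tsum_measure_returnSet` adds up the parts.
  have h1 : μ (returnMap T P ⁻¹' A ∩ P) = μ (⋃ k, returnSet T P (A ∩ P) k ∩ P) := by
    refine measure_congr ?_
    have := ae_exists_mem_returnSet hT hP
    rw [ae_restrict_iff' hP] at this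
    filter_upwards [this] with y hy
    refine propext ⟨fun h => ?_, fun h => ?_⟩
    · obtain ⟨k, hk⟩ := hy h.2
      have h3 := h.1
      rw [mem_preimage, returnMap_eq hk] at h3
      exact mem_iUnion.2 ⟨k, ⟨hk.1, h3, hk.2⟩, h.2⟩
    · obtain ⟨k, hk⟩ := mem_iUnion.1 h
      refine ⟨?_, hk.2⟩
      rw [mem_preimage, returnMap_eq ⟨hk.1.1, hk.1.2.2⟩]
      exact hk.1.2.1
  rw [h1, measure_iUnion, tsum_measure_returnSet hT hP (hA.inter hP) inter_subset_right]
  · intro j k hjk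
    have := pairwise_disjoint_returnSet (T := T) (P := P) hjk
    have hsub : ∀ i, returnSet T P (A ∩ P) i ∩ P ⊆ returnSet T P P i ∩ P :=
      fun i y hy => ⟨⟨hy.1.1, hy.1.2.2⟩, hy.2⟩
    exact this.mono (hsub j) (hsub k)
  · exact fun k => (measurableSet_returnSet hT.measurable hP (hA.inter hP) k).inter hP

end Recurrence

end

/-! ### Reflections and the invariance of the flux measure under the billiard map. -/

section

/-- The reflection in the hyperplane orthogonal to a unit vector, as a linear isometry. -/
def reflectIsometry {d : ℕ} (u : E d) (hu : ‖u‖ = 1) : E d ≃ₗᵢ[ℝ] E d where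
  toFun := reflect u
  map_add' x y := by
    simp only [reflect, inner_add_left]
    module
  map_smul' r x := by
    simp only [reflect, inner_smul_left, RingHom.id_apply]
    simp only [conj_trivial]
    module
  invFun := reflect u
  left_inv x := by
    simp only [reflect, inner_sub_left, inner_smul_left, real_inner_self_eq_norm_sq, hu]
    simp only [conj_trivial]
    module
  right_inv x := by
    simp only [reflect, inner_sub_left, inner_smul_left, real_inner_self_eq_norm_sq, hu]
    simp only [conj_trivial]
    module
  norm_map' x := by
    change ‖reflect u x‖ = ‖x‖
    rw [← sq_eq_sq₀ (norm_nonneg _) (norm_nonneg _), reflect, norm_sub_sq_real, norm_smul, hu,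
      inner_smul_right, mul_one, Real.norm_eq_abs, sq_abs]
    ring

theorem inner_reflect {d : ℕ} {u : E d} (hu : ‖u‖ = 1) (x : E d) :
    inner ℝ (reflect u x) u = -inner ℝ x u := by
  rw [reflect, inner_sub_left, inner_smul_left, real_inner_self_eq_norm_sq, hu]
  simp only [conj_trivial]
  ring

theorem reflect_neg {d : ℕ} (u x : E d) : reflect (-u) x = reflect u x := by
  simp only [reflect, inner_neg_right]
  module

/-- The properties of a distribution of velocities that make the billiard map
preserve the associated flux measure. -/
structure IsReflectionInvariant {d : ℕ} (ν : Measure (E (d + 1))) : Prop where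
  isFiniteMeasure : IsFiniteMeasure ν
  lintegral_enorm_lt_top : ∫⁻ v, ‖v‖ₑ ∂ν < ⊤
  ae_ne_zero : ∀ᵐ v ∂ν, v (Fin.last d) ≠ 0
  map_reflect : ∀ u : E (d + 1), ‖u‖ = 1 → ν.map (reflect u) = ν

variable {n : ℕ} {a : Fin n → ℝ}

open Classical in
/-- The unit normal vector to the boundary pointing into the region. -/
def inward (F : Torus a → ℝ) (c : ℝ) (q : Torus a × ℝ) : E (n + 1) :=
  if q.2 = c then -EuclideanSpace.single (Fin.last n) 1 else normal F q.1

/-- Free flight followed by a reflection, on pairs of a boundary point and an outgoing velocity. -/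
def billiardStep (F : Torus a → ℝ) (c : ℝ) (p : (Torus a × ℝ) × E (n + 1)) :
    (Torus a × ℝ) × E (n + 1) :=
  (land F c p.2 p.1, reflect (inward F c (land F c p.2 p.1)) p.2)

theorem norm_toLp_snoc_sq (g : E n) : ‖(WithLp.toLp 2
    (Fin.snoc (α := fun _ => ℝ) (fun i => -(g i)) 1) : E (n + 1))‖ ^ 2 = 1 + ‖g‖ ^ 2 := by
  rw [EuclideanSpace.norm_sq_eq, EuclideanSpace.norm_sq_eq, Fin.sum_univ_castSucc]
  simp [add_comm]

theorem norm_normal (F : Torus a → ℝ) (x : Torus a) : ‖normal F x‖ = 1 := by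
  have h : (0 : ℝ) < 1 + ‖grad F x‖ ^ 2 := by positivity
  have h2 : ‖(WithLp.toLp 2 (Fin.snoc (α := fun _ => ℝ) (fun i => -(grad F x i)) 1) :
      E (n + 1))‖ = √(1 + ‖grad F x‖ ^ 2) := by
    rw [← norm_toLp_snoc_sq, Real.sqrt_sq (norm_nonneg _)]
  rw [normal, norm_smul, h2, norm_inv, Real.norm_of_nonneg (Real.sqrt_nonneg _)]
  exact inv_mul_cancel₀ (Real.sqrt_pos.2 h).ne'

theorem inner_normal (F : Torus a → ℝ) (x : Torus a) (v : E (n + 1)) :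
    inner ℝ v (normal F x) = (√(1 + ‖grad F x‖ ^ 2))⁻¹ * vertSpeed F v x := by
  rw [normal, inner_smul_right, vertSpeed]
  congr 1
  simp only [PiLp.inner_apply, Fin.sum_univ_castSucc, horiz]
  simp [mul_comm]
  ring

theorem norm_inward (F : Torus a → ℝ) (c : ℝ) (q : Torus a × ℝ) : ‖inward F c q‖ = 1 := by
  unfold inward
  split_ifs
  · simp
  · exact norm_normal F q.1

/-- The factor `s` is the surface area per unit horizontal area: `√(1 + |grad F|²)` on the graph and
`1` on the lid. With it, `flux` behaves under reflections like the normal component of the velocity.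
-/
theorem flux_eq_inner (F : Torus a → ℝ) (c : ℝ) (q : Torus a × ℝ) :
    ∃ s > 0, ∀ v, flux F c v q = s * inner ℝ v (inward F c q) := by
  unfold flux inward
  split_ifs with h
  · refine ⟨1, one_pos, fun v => ?_⟩
    simp [inner_neg_right, EuclideanSpace.inner_single_right]
  · have hpos : 0 < √(1 + ‖grad F q.1‖ ^ 2) := Real.sqrt_pos.2 (by positivity)
    refine ⟨_, hpos, fun v => ?_⟩
    rw [inner_normal, mul_inv_cancel_left₀ hpos.ne']

theorem flux_reflect (F : Torus a → ℝ) (c : ℝ) (q : Torus a × ℝ) (v : E (n + 1)) :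
    flux F c (reflect (inward F c q) v) q = -flux F c v q := by
  obtain ⟨s, -, h⟩ := flux_eq_inner F c q
  rw [h, h, inner_reflect (norm_inward F c q), mul_neg]

theorem abs_flux_le (F : Torus a → ℝ) (c : ℝ) (q : Torus a × ℝ) (v : E (n + 1)) :
    |flux F c v q| ≤ ‖v‖ * (1 + ‖grad F q.1‖) := by
  have h1 : |v (Fin.last n)| ≤ ‖v‖ := PiLp.norm_apply_le v (Fin.last n)
  have h2 : ‖horiz v‖ ≤ ‖v‖ := by
    rw [← sq_le_sq₀ (norm_nonneg _) (norm_nonneg _), EuclideanSpace.norm_sq_eq,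
      EuclideanSpace.norm_sq_eq, Fin.sum_univ_castSucc]
    exact le_add_of_nonneg_right (by positivity)
  have h0 := norm_nonneg (grad F q.1)
  unfold flux vertSpeed
  split_ifs with h
  · rw [abs_neg]
    nlinarith [norm_nonneg v]
  · have h3 := abs_real_inner_le_norm (grad F q.1) (horiz v)
    have h4 := abs_sub (v (Fin.last n)) (inner ℝ (grad F q.1) (horiz v))
    nlinarith

theorem measurable_normal {F : Torus a → ℝ} (hF : Continuous F) : Measurable (normal F) := by
  have hg := measurable_grad hF
  unfold normal
  refine Measurable.smul (f := fun x => (√(1 + ‖grad F x‖ ^ 2))⁻¹) ?_ ?_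
  · exact ((hg.norm.pow_const 2).const_add 1).sqrt.inv
  · refine (WithLp.measurable_toLp 2 _).comp (measurable_pi_iff.2 fun i => ?_)
    induction i using Fin.lastCases with
    | last => simp
    | cast i =>
      simp only [Fin.snoc_castSucc]
      exact ((Continuous.measurable (by fun_prop) : Measurable fun g : E n => g i).comp hg).neg

theorem measurable_inward {F : Torus a → ℝ} (hF : Continuous F) (c : ℝ) :
    Measurable (inward F c) := by
  unfold inward
  exact Measurable.ite (measurableSet_eq_fun measurable_snd measurable_const) measurable_const
    ((measurable_normal hF).comp measurable_fst)

theorem measurable_reflect_inward {F : Torus a → ℝ} (hF : Continuous F) (c : ℝ) :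
    Measurable fun p : (Torus a × ℝ) × E (n + 1) => reflect (inward F c p.1) p.2 := by
  have h := (measurable_inward hF c).comp
    (measurable_fst : Measurable (Prod.fst : (Torus a × ℝ) × E (n + 1) → _))
  unfold reflect
  have h2 : Measurable fun p : (Torus a × ℝ) × E (n + 1) =>
      2 * inner ℝ p.2 (inward F c p.1) := (measurable_snd.inner h).const_mul 2
  exact measurable_snd.sub (h2.smul h)

theorem measurable_billiardStep {F : Torus a → ℝ} (hF : Continuous F) (c : ℝ) :
    Measurable (billiardStep F c) := by
  have h := measurable_land hF c
  exact h.prodMk ((measurable_reflect_inward hF c).comp (h.prodMk measurable_snd))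

variable [∀ i, Fact (0 < a i)]

/-- The flux measure on pairs of a boundary point and an outgoing velocity with distribution `ν`. -/
def fluxMeasure (F : Torus a → ℝ) (c : ℝ) (ν : Measure (E (n + 1))) :
    Measure ((Torus a × ℝ) × E (n + 1)) :=
  ((wallMeasure F c).prod ν).withDensity fun p => ENNReal.ofReal (flux F c p.2 p.1)

theorem isFiniteMeasure_wallMeasure (F : Torus a → ℝ) (c : ℝ) :
    IsFiniteMeasure (wallMeasure F c) := by
  unfold wallMeasure
  infer_instance

theorem IsPiecewiseSmooth.lintegral_grad_lt_top {F : Torus a → ℝ} (hF : IsPiecewiseSmooth F) :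
    ∫⁻ x, ‖grad F x‖ₑ ∂(uniform a) < ⊤ := by
  rw [lintegral_uniform (measurable_grad hF.continuous).enorm]
  refine ENNReal.mul_lt_top density_ne_top.lt_top ?_
  have hK : IsCompact (WithLp.toLp 2 '' (univ.pi fun i => Icc 0 (0 + a i)) : Set (E n)) :=
    (isCompact_univ_pi fun i => isCompact_Icc).image (PiLp.continuous_toLp 2 _)
  have hsub : box a ⊆ WithLp.toLp 2 '' (univ.pi fun i => Icc 0 (0 + a i)) :=
    fun y hy => ⟨y.ofLp, fun i _ => Ioc_subset_Icc_self (hy i), rfl⟩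
  have h := (hF.locallyIntegrable_fderiv.integrableOn_isCompact hK).mono_set hsub
  refine lt_of_eq_of_lt (lintegral_congr fun y => ?_) h.2
  rw [enorm_norm, ← ofReal_norm, ← ofReal_norm, grad, gradient, LinearIsometryEquiv.norm_map,
    chart_toTorus, fderiv_comp_add_left (f := fun u => F (toTorus a u)), add_zero]

theorem IsPiecewiseSmooth.isFiniteMeasure_fluxMeasure {F : Torus a → ℝ}
    (hF : IsPiecewiseSmooth F) (c : ℝ) {ν : Measure (E (n + 1))} (hν : IsReflectionInvariant ν) :
    IsFiniteMeasure (fluxMeasure F c ν) := by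
  have := isFiniteMeasure_wallMeasure F c
  have := hν.isFiniteMeasure
  have hg := (measurable_grad hF.continuous).enorm
  refine ⟨?_⟩
  rw [fluxMeasure, withDensity_apply _ MeasurableSet.univ, Measure.restrict_univ]
  have hle : ∀ p : (Torus a × ℝ) × E (n + 1),
      ENNReal.ofReal (flux F c p.2 p.1) ≤ (1 + ‖grad F p.1.1‖ₑ) * ‖p.2‖ₑ := by
    intro p
    refine (ENNReal.ofReal_le_ofReal ((le_abs_self _).trans (abs_flux_le F c p.1 p.2))).trans ?_
    rw [mul_comm, ENNReal.ofReal_mul (by positivity), ENNReal.ofReal_add (by positivity)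
      (by positivity), ofReal_norm, ofReal_norm, ENNReal.ofReal_one]
  refine (lintegral_mono hle).trans_lt ?_
  rw [lintegral_prod_mul (f := fun q : Torus a × ℝ => 1 + ‖grad F q.1‖ₑ)
    (g := fun v : E (n + 1) => ‖v‖ₑ)
    ((hg.comp measurable_fst).const_add 1).aemeasurable measurable_enorm.aemeasurable]
  refine ENNReal.mul_lt_top ?_ hν.lintegral_enorm_lt_top
  rw [lintegral_wallMeasure hF.continuous c (g := fun q => 1 + ‖grad F q.1‖ₑ)
    ((hg.comp measurable_fst).const_add 1)]
  have h2 : ∫⁻ x, (1 + ‖grad F x‖ₑ) ∂(uniform a) < ⊤ := by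
    rw [lintegral_add_left measurable_const]
    exact ENNReal.add_lt_top.2 ⟨by simp, hF.lintegral_grad_lt_top⟩
  exact ENNReal.add_lt_top.2 ⟨h2, h2⟩

theorem lintegral_outMeasure {F : Torus a → ℝ} (hF : Continuous F) (c : ℝ) (v : E (n + 1))
    {g : Torus a × ℝ → ENNReal} (hg : Measurable g) :
    ∫⁻ q, g q ∂(outMeasure F c v) =
      ∫⁻ q, ENNReal.ofReal (flux F c v q) * g q ∂(wallMeasure F c) := by
  rw [outMeasure, lintegral_withDensity_eq_lintegral_mul _
    (measurable_flux_right hF c v).ennreal_ofReal hg]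
  rfl

theorem lintegral_fluxMeasure {F : Torus a → ℝ} (hF : Continuous F) (c : ℝ)
    {ν : Measure (E (n + 1))} {g : (Torus a × ℝ) × E (n + 1) → ENNReal} (hg : Measurable g) :
    ∫⁻ p, g p ∂(fluxMeasure F c ν) =
      ∫⁻ p, ENNReal.ofReal (flux F c p.2 p.1) * g p ∂((wallMeasure F c).prod ν) := by
  rw [fluxMeasure, lintegral_withDensity_eq_lintegral_mul _ (measurable_flux hF c).ennreal_ofReal hg]
  rfl

/-- The billiard map preserves the flux measure. -/
theorem IsPiecewiseSmooth.measurePreserving_billiardStep {F : Torus a → ℝ}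
    (hF : IsPiecewiseSmooth F) {c : ℝ} (hc : ∀ x, F x < c) {ν : Measure (E (n + 1))}
    (hν : IsReflectionInvariant ν) :
    MeasurePreserving (billiardStep F c) (fluxMeasure F c ν) (fluxMeasure F c ν) := by
  have := isFiniteMeasure_wallMeasure F c
  have := hν.isFiniteMeasure
  have hcont := hF.continuous
  have hs := measurable_billiardStep hcont c
  have hfm := (measurable_flux hcont c).ennreal_ofReal
  refine ⟨hs, Measure.ext_of_lintegral _ fun g hg => ?_⟩
  have hbm : Measurable fun p : (Torus a × ℝ) × E (n + 1) =>
      (p.1, reflect (inward F c p.1) p.2) :=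
    measurable_fst.prodMk (measurable_reflect_inward hcont c)
  have hnegm : Measurable fun p : (Torus a × ℝ) × E (n + 1) =>
      ENNReal.ofReal (flux F c (-p.2) p.1) :=
    hfm.comp (measurable_fst.prodMk measurable_snd.neg)
  have hgb : Measurable fun p : (Torus a × ℝ) × E (n + 1) =>
      g (p.1, reflect (inward F c p.1) p.2) := hg.comp hbm
  have hgs : Measurable fun p => g (billiardStep F c p) := hg.comp hs
  have hm1 : Measurable fun p : (Torus a × ℝ) × E (n + 1) =>
      ENNReal.ofReal (flux F c p.2 p.1) * g (billiardStep F c p) := hfm.mul hgs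
  have hm2 : Measurable fun p : (Torus a × ℝ) × E (n + 1) =>
      ENNReal.ofReal (flux F c (-p.2) p.1) * g (p.1, reflect (inward F c p.1) p.2) :=
    hnegm.mul hgb
  have hm3 : Measurable fun p : (Torus a × ℝ) × E (n + 1) =>
      ENNReal.ofReal (flux F c p.2 p.1) * g p := hfm.mul hg
  rw [lintegral_map hg hs, lintegral_fluxMeasure hcont c hgs,
    lintegral_fluxMeasure hcont c hg, lintegral_prod_symm _ hm1.aemeasurable]
  -- At fixed velocity, `map_land` moves the integral to the landing points, where the weight is the
  -- flux of `-v`.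
  have h1 : ∀ᵐ v ∂ν, ∫⁻ q, ENNReal.ofReal (flux F c v q) * g (billiardStep F c (q, v))
      ∂(wallMeasure F c) = ∫⁻ q, ENNReal.ofReal (flux F c (-v) q) *
        g (q, reflect (inward F c q) v) ∂(wallMeasure F c) := by
    filter_upwards [hν.ae_ne_zero] with v hv
    have hgv : Measurable fun q => g (q, reflect (inward F c q) v) :=
      hgb.comp (measurable_id.prodMk measurable_const)
    rw [← lintegral_outMeasure hcont c (-v) hgv, ← hF.map_land hc hv,
      lintegral_map hgv (measurable_land_right hcont c v), lintegral_outMeasure hcont c v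
        (g := fun q => g (land F c v q, reflect (inward F c (land F c v q)) v)) (hgv.comp (measurable_land_right hcont c v))]
    rfl
  rw [lintegral_congr_ae h1, ← lintegral_prod_symm (fun p : (Torus a × ℝ) × E (n + 1) =>
    ENNReal.ofReal (flux F c (-p.2) p.1) * g (p.1, reflect (inward F c p.1) p.2))
      hm2.aemeasurable, lintegral_prod _ hm2.aemeasurable,
    lintegral_prod _ hm3.aemeasurable]
  -- At a fixed boundary point, substituting the reflected velocity preserves `ν` and turns the flux
  -- of `v` into that of `-v`.
  refine lintegral_congr fun q => ?_
  have hr : Measurable (reflect (inward F c q)) :=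
    (reflectIsometry _ (norm_inward F c q)).continuous.measurable
  have hgq : Measurable fun v => ENNReal.ofReal (flux F c v q) * g (q, v) :=
    hm3.comp (measurable_const.prodMk measurable_id)
  conv_rhs => rw [← hν.map_reflect _ (norm_inward F c q), lintegral_map hgq hr]
  refine lintegral_congr fun v => ?_
  rw [flux_reflect, flux_neg]

end

/-! ### The scattering map as the first return map to the lid. -/

section

variable {n : ℕ} {a : Fin n → ℝ}

/-- The distribution of the flux of downward velocities through the reference plane. -/
def downMeasure {d : ℕ} (ν : Measure (E (d + 1))) : Measure (E (d + 1)) :=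
  ν.withDensity fun v => ENNReal.ofReal (-v (Fin.last d))

/-- The pairs of a boundary point and an outgoing, non-horizontal velocity. -/
def outgoing (F : Torus a → ℝ) (c : ℝ) : Set ((Torus a × ℝ) × E (n + 1)) :=
  {p | p.1 ∈ outPts F c p.2 ∧ p.2 (Fin.last n) ≠ 0}

/-- The part of the phase space of the boundary lying over the reference plane. -/
def planePhase (a : Fin n → ℝ) (c : ℝ) : Set ((Torus a × ℝ) × E (n + 1)) := {p | p.1.2 = c}

/-- The state of a particle at a boundary point. -/
def toState (p : (Torus a × ℝ) × E (n + 1)) : State a := ⟨p.1.1, p.1.2, p.2⟩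

theorem FreeFlight.not_lt {F : Torus a → ℝ} {s : State a} {t t' : ℝ} (h : FreeFlight F s t')
    (h0 : 0 < t) (ht : (s.fly t).height = F (s.fly t).pos) : t' ≤ t := by
  by_contra! hlt
  exact (h.2 t h0 hlt).ne ht.symm

theorem Collision.unique {F : Torus a → ℝ} {s s₁ s₂ : State a} (h₁ : Collision F s s₁)
    (h₂ : Collision F s s₂) : s₁ = s₂ := by
  obtain ⟨t₁, hf₁, he₁, -, -, rfl⟩ := h₁
  obtain ⟨t₂, hf₂, he₂, -, -, rfl⟩ := h₂
  obtain rfl := le_antisymm (hf₁.not_lt hf₂.1 he₂) (hf₂.not_lt hf₁.1 he₁)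
  rfl

theorem height_le_of_chain {F : Torus a → ℝ} {c : ℝ} (hc : ∀ x, F x < c) {s s' : State a}
    (h0 : s.height ≤ c) (h : Relation.ReflTransGen (Collision F) s s') : s'.height ≤ c := by
  rcases Relation.ReflTransGen.cases_tail h with rfl | ⟨r, -, t, -, he, -, -, rfl⟩
  · exact h0
  · exact he ▸ (hc _).le

/-- After a free flight to the reference plane no collision takes place. -/
theorem Collision.not_freeFlight {F : Torus a → ℝ} {c : ℝ} (hc : ∀ x, F x < c) {s s' : State a}
    (hs : s.height ≤ c) (h : Collision F s s') {t : ℝ} (hf : FreeFlight F s t) :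
    (s.fly t).height ≠ c := by
  intro ht
  obtain ⟨r, hr, he, -⟩ := h
  have hlt : (s.fly r).height < c := he ▸ hc _
  -- The height is affine in time and starts at or below `c`; having reached `c` at time `t`, it
  -- cannot be below `c` at the collision time `r ≥ t`.
  have hle := hf.not_lt hr.1 he
  have h0 := hf.1
  simp only [State.fly] at hlt ht
  nlinarith

/-- Collisions are deterministic, so one chain of collisions extends the other, and no collision can
follow a flight that reaches the lid. This makes the choice in `scatter` harmless. -/
theorem Returns.unique {F : Torus a → ℝ} {c : ℝ} (hc : ∀ x, F x < c) {x : Torus a}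
    {ξ V V' : E (n + 1)} (h : Returns F c x ξ V) (h' : Returns F c x ξ V') : V = V' := by
  obtain ⟨s, hs, t, hf, ht, rfl⟩ := h
  obtain ⟨s', hs', t', hf', ht', rfl⟩ := h'
  have key : ∀ {s s' : State a} {t : ℝ}, s.height ≤ c → FreeFlight F s t →
      (s.fly t).height = c → Relation.ReflTransGen (Collision F) s s' → s = s' := by
    intro s s' t hle hf ht h
    rcases Relation.ReflTransGen.cases_head h with rfl | ⟨r, hr, -⟩
    · rfl
    · exact absurd ht (hr.not_freeFlight hc hle hf)
  have hss : s = s' := by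
    rcases Relation.ReflTransGen.total_of_right_unique (fun _ _ _ => Collision.unique) hs hs'
      with h | h
    · exact key (height_le_of_chain hc le_rfl hs) hf ht h
    · exact (key (height_le_of_chain hc le_rfl hs') hf' ht' h).symm
  rw [hss]

theorem scatter_eq {F : Torus a → ℝ} {c : ℝ} (hc : ∀ x, F x < c) {x : Torus a}
    {ξ V : E (n + 1)} (h : Returns F c x ξ V) : scatter F c x ξ = V := by
  have hex : ∃ V, Returns F c x ξ V := ⟨V, h⟩
  rw [scatter, dif_pos hex]
  exact hex.choose_spec.unique hc h

theorem measurableSet_planePhase (c : ℝ) : MeasurableSet (planePhase a c) :=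
  measurableSet_eq_fun (measurable_snd.comp measurable_fst) measurable_const

variable [∀ i, Fact (0 < a i)]

theorem freeFlight_exitTime {F : Torus a → ℝ} (hF : Continuous F) {c : ℝ} (hc : ∀ x, F x < c)
    {p : (Torus a × ℝ) × E (n + 1)} (hp : p ∈ outgoing F c) :
    FreeFlight F (toState p) (exitTime F c p.2 p.1) := by
  obtain ⟨h0, hf, -⟩ := land_spec hF hc hp.2 hp.1
  exact ⟨h0, fun r h1 h2 => (hf r h1 h2).1⟩

/-- That the next state is outgoing supplies both the tangent plane and transversality: positive
flux after the reflection means negative normal velocity before it. -/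
theorem collision_billiardStep {F : Torus a → ℝ} (hF : Continuous F) {c : ℝ} (hc : ∀ x, F x < c)
    {p : (Torus a × ℝ) × E (n + 1)} (hp : p ∈ outgoing F c) (hp' : billiardStep F c p ∈ outgoing F c)
    (hne : billiardStep F c p ∉ planePhase a c) :
    Collision F (toState p) (toState (billiardStep F c p)) := by
  have hne2 : (land F c p.2 p.1).2 ≠ c := hne
  obtain ⟨he, hd⟩ := hp'.1.1.resolve_left hne2
  have hin : inward F c (land F c p.2 p.1) = normal F (land F c p.2 p.1).1 := if_neg hne2
  have hfl := hp'.1.2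
  refine ⟨exitTime F c p.2 p.1, freeFlight_exitTime hF hc hp, he, hd, ?_, ?_⟩
  · simp only [billiardStep] at hfl
    rw [flux_reflect] at hfl
    obtain ⟨s, hs, h⟩ := flux_eq_inner F c (land F c p.2 p.1)
    rw [h, hin, neg_pos] at hfl
    exact (pos_iff_neg_of_mul_neg hfl).1 hs
  · simp only [billiardStep, hin]
    rfl

theorem returns_of_mem_returnSet {F : Torus a → ℝ} (hF : Continuous F) {c : ℝ}
    (hc : ∀ x, F x < c) {x : Torus a} {ξ : E (n + 1)} {k : ℕ}
    (hgood : ∀ i, (billiardStep F c)^[i] ((x, c), ξ) ∈ outgoing F c)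
    (hk : ((x, c), ξ) ∈ returnSet (billiardStep F c) (planePhase a c) (planePhase a c) k) :
    Returns F c x ξ ((billiardStep F c)^[k + 1] ((x, c), ξ)).2 := by
  have hchain : ∀ i ≤ k, Relation.ReflTransGen (Collision F) ⟨x, c, ξ⟩
      (toState ((billiardStep F c)^[i] ((x, c), ξ))) := by
    intro i
    induction i with
    | zero => exact fun _ => Relation.ReflTransGen.refl
    | succ i ih =>
      intro hi
      refine (ih (by omega)).tail ?_
      have h1 := hgood (i + 1)
      have h2 := hk.1 i (by omega)
      rw [Function.iterate_succ_apply'] at h1 h2 ⊢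
      exact collision_billiardStep hF hc (hgood i) h1 h2
  have hret := hk.2
  rw [Function.iterate_succ_apply'] at hret ⊢
  set p := (billiardStep F c)^[k] ((x, c), ξ)
  have hpl : (land F c p.2 p.1).2 = c := hret
  refine ⟨toState p, hchain k le_rfl, exitTime F c p.2 p.1,
    freeFlight_exitTime hF hc (hgood k), hpl, ?_⟩
  simp only [billiardStep]
  -- The inward normal of the lid is `-e`, and a reflection does not see the sign. The last billiard
  -- step thus already includes the reflection in the definition of `Returns`.
  rw [inward, if_pos hpl, reflect_neg]
  rfl

theorem IsPiecewiseSmooth.ae_mem_outgoing {F : Torus a → ℝ} (hF : IsPiecewiseSmooth F) (c : ℝ)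
    {ν : Measure (E (n + 1))} (hν : IsReflectionInvariant ν) :
    ∀ᵐ p ∂(fluxMeasure F c ν), p ∈ outgoing F c := by
  have := isFiniteMeasure_wallMeasure F c
  have := hν.isFiniteMeasure
  rw [fluxMeasure, ae_withDensity_iff (measurable_flux hF.continuous c).ennreal_ofReal]
  have h1 : ∀ᵐ q ∂(wallMeasure F c), q ∈ smoothWall F c :=
    ae_iff.2 (hF.wallMeasure_compl_smoothWall c)
  filter_upwards [Measure.quasiMeasurePreserving_fst.ae h1,
    Measure.quasiMeasurePreserving_snd.ae hν.ae_ne_zero] with p hp1 hp2 hp3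
  exact ⟨⟨hp1, ENNReal.ofReal_pos.1 (pos_iff_ne_zero.2 hp3)⟩, hp2⟩

/-- On the lid the flux is `-v_last`, whatever the position, so the measure is a product; the graph,
lying strictly below, contributes nothing. -/
theorem restrict_planePhase {F : Torus a → ℝ} (hF : Continuous F) {c : ℝ} (hc : ∀ x, F x < c)
    {ν : Measure (E (n + 1))} (hν : IsReflectionInvariant ν) :
    (fluxMeasure F c ν).restrict (planePhase a c) =
      ((uniform a).prod (downMeasure ν)).map fun p => ((p.1, c), p.2) := by
  have := isFiniteMeasure_wallMeasure F c
  have := hν.isFiniteMeasure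
  have hm : Measurable fun p : Torus a × E (n + 1) => ((p.1, c), p.2) := by fun_prop
  have hl : Measurable fun v : E (n + 1) => ENNReal.ofReal (-v (Fin.last n)) :=
    Measurable.ennreal_ofReal (Continuous.measurable (by fun_prop))
  have hP := measurableSet_planePhase (a := a) c
  refine Measure.ext_of_lintegral _ fun g hg => ?_
  have hgi : Measurable ((planePhase a c).indicator g) := hg.indicator hP
  have hfm := (measurable_flux hF c).ennreal_ofReal
  have hpm : Measurable fun p : (Torus a × ℝ) × E (n + 1) =>
      ENNReal.ofReal (flux F c p.2 p.1) * (planePhase a c).indicator g p := hfm.mul hgi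
  have hgm : Measurable fun p : Torus a × E (n + 1) => g ((p.1, c), p.2) := hg.comp hm
  have hsf : SFinite (downMeasure ν) := by unfold downMeasure; infer_instance
  rw [← lintegral_indicator hP, lintegral_fluxMeasure hF c hgi, lintegral_map hg hm,
    lintegral_prod _ hpm.aemeasurable, lintegral_prod _ hgm.aemeasurable,
    lintegral_wallMeasure hF c hpm.lintegral_prod_right']
  have h0 : ∀ x, ∫⁻ v, ENNReal.ofReal (flux F c v (x, F x)) *
      (planePhase a c).indicator g ((x, F x), v) ∂ν = 0 := by
    intro x
    have : ∀ v : E (n + 1), ((x, F x), v) ∉ planePhase a c := fun v => (hc x).ne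
    simp [this]
  simp only [h0, lintegral_zero, zero_add]
  refine lintegral_congr fun x => ?_
  have hgx : Measurable fun v => g ((x, c), v) := hg.comp (measurable_const.prodMk measurable_id)
  rw [downMeasure, lintegral_withDensity_eq_lintegral_mul _ hl hgx]
  refine lintegral_congr fun v => ?_
  have h1 : ((x, c), v) ∈ planePhase a c := rfl
  rw [indicator_of_mem h1, flux, if_pos rfl]
  rfl

/-- The scattering map is almost everywhere defined and preserves the flux of velocities. -/
theorem IsPiecewiseSmooth.scatter_invariant {F : Torus a → ℝ} (hF : IsPiecewiseSmooth F) {c : ℝ}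
    (hc : ∀ x, F x < c) {ν : Measure (E (n + 1))} (hν : IsReflectionInvariant ν) :
    (∀ᵐ p ∂((uniform a).prod (downMeasure ν)), ∃ V, Returns F c p.1 p.2 V) ∧
      AEMeasurable (fun p => scatter F c p.1 p.2) ((uniform a).prod (downMeasure ν)) ∧
      ((uniform a).prod (downMeasure ν)).map (fun p => scatter F c p.1 p.2) = downMeasure ν := by
  have := hF.isFiniteMeasure_fluxMeasure c hν
  have := hν.isFiniteMeasure
  have hsf : SFinite (downMeasure ν) := by unfold downMeasure; infer_instance
  have hcont := hF.continuous
  have hT := hF.measurePreserving_billiardStep hc hν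
  have hP := measurableSet_planePhase (a := a) c
  have hm : Measurable fun p : Torus a × E (n + 1) => ((p.1, c), p.2) := by fun_prop
  have hR := measurable_returnMap hT.measurable hP
  -- Invariance carries the full-measure property of outgoing states to every iterate, and there are
  -- countably many.
  have hall : ∀ᵐ y ∂(fluxMeasure F c ν), ∀ i, (billiardStep F c)^[i] y ∈ outgoing F c :=
    ae_all_iff.2 fun i => (hT.iterate i).quasiMeasurePreserving.ae (hF.ae_mem_outgoing c hν)
  have hret := ae_exists_mem_returnSet hT hP
  have hboth := (ae_restrict_of_ae (s := planePhase a c) hall).and hret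
  rw [restrict_planePhase hcont hc hν] at hboth
  have hboth' := ae_of_ae_map hm.aemeasurable hboth
  have hspec : ∀ᵐ p ∂((uniform a).prod (downMeasure ν)), Returns F c p.1 p.2
      (returnMap (billiardStep F c) (planePhase a c) ((p.1, c), p.2)).2 := by
    filter_upwards [hboth'] with p hp
    obtain ⟨hgood, k, hk⟩ := hp
    rw [returnMap_eq hk]
    exact returns_of_mem_returnSet hcont hc hgood hk
  have heq : (fun p => scatter F c p.1 p.2) =ᵐ[(uniform a).prod (downMeasure ν)]
      fun p => (returnMap (billiardStep F c) (planePhase a c) ((p.1, c), p.2)).2 := by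
    filter_upwards [hspec] with p hp using scatter_eq hc hp
  have hmeas : Measurable fun p : Torus a × E (n + 1) =>
      (returnMap (billiardStep F c) (planePhase a c) ((p.1, c), p.2)).2 :=
    measurable_snd.comp (hR.comp hm)
  refine ⟨hspec.mono fun p hp => ⟨_, hp⟩, hmeas.aemeasurable.congr heq.symm, ?_⟩
  rw [Measure.map_congr heq]
  have h1 : (fun p : Torus a × E (n + 1) =>
      (returnMap (billiardStep F c) (planePhase a c) ((p.1, c), p.2)).2) =
      Prod.snd ∘ returnMap (billiardStep F c) (planePhase a c) ∘
        fun p : Torus a × E (n + 1) => ((p.1, c), p.2) := rfl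
  rw [h1, ← Measure.map_map measurable_snd (hR.comp hm), ← Measure.map_map hR hm,
    ← restrict_planePhase hcont hc hν, map_returnMap hT hP, restrict_planePhase hcont hc hν,
    Measure.map_map measurable_snd hm]
  have h2 : (Prod.snd ∘ fun p : Torus a × E (n + 1) => ((p.1, c), p.2)) = Prod.snd := rfl
  rw [h2, Measure.map_snd_prod, measure_univ, one_smul]

end

/-! ### Hidden and observed velocities: a criterion for stationarity. -/

section

section Join

variable {k l : ℕ}

theorem join_castAdd (w : E k) (v : E (l + 1)) (j : Fin k) :
    join w v (Fin.castAdd (l + 1) j : Fin (k + (l + 1))) = w j :=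
  Fin.append_left w.ofLp v.ofLp j

theorem join_natAdd (w : E k) (v : E (l + 1)) (j : Fin (l + 1)) :
    join w v (Fin.natAdd k j : Fin (k + (l + 1))) = v j :=
  Fin.append_right w.ofLp v.ofLp j

theorem observed_join (w : E k) (v : E (l + 1)) : observed (join w v) = v := by
  ext j
  exact Fin.append_right w.ofLp v.ofLp j

theorem join_last (w : E k) (v : E (l + 1)) :
    join w v (Fin.last (k + l)) = v (Fin.last l) :=
  Fin.append_right w.ofLp v.ofLp (Fin.last l)

theorem norm_join_sq (w : E k) (v : E (l + 1)) : ‖join w v‖ ^ 2 = ‖w‖ ^ 2 + ‖v‖ ^ 2 := by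
  rw [EuclideanSpace.norm_sq_eq, EuclideanSpace.norm_sq_eq, EuclideanSpace.norm_sq_eq]
  refine (Fin.sum_univ_add (fun i : Fin (k + (l + 1)) =>
    ‖(Fin.append w.ofLp v.ofLp : Fin (k + (l + 1)) → ℝ) i‖ ^ 2)).trans ?_
  simp only [Fin.append_left, Fin.append_right]

/-- `join` as a linear isometry. -/
def joinIsometry (k l : ℕ) : WithLp 2 (E k × E (l + 1)) ≃ₗᵢ[ℝ] E (k + l + 1) where
  toFun p := join p.fst p.snd
  map_add' p q := by
    ext i
    refine Fin.addCases (m := k) (n := l + 1) (fun j => ?_) (fun j => ?_) i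
    · exact (join_castAdd _ _ j).trans
        (congrArg₂ (· + ·) (join_castAdd p.fst p.snd j).symm (join_castAdd q.fst q.snd j).symm)
    · exact (join_natAdd _ _ j).trans
        (congrArg₂ (· + ·) (join_natAdd p.fst p.snd j).symm (join_natAdd q.fst q.snd j).symm)
  map_smul' r p := by
    ext i
    refine Fin.addCases (m := k) (n := l + 1) (fun j => ?_) (fun j => ?_) i
    · exact (join_castAdd _ _ j).trans (congrArg (r * ·) (join_castAdd p.fst p.snd j).symm)
    · exact (join_natAdd _ _ j).trans (congrArg (r * ·) (join_natAdd p.fst p.snd j).symm)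
  invFun ξ := WithLp.toLp 2
    (WithLp.toLp 2 fun i : Fin k => ξ (Fin.castAdd (l + 1) i : Fin (k + (l + 1))), observed ξ)
  left_inv p := by
    refine (WithLp.ofLp_injective 2) (Prod.ext ?_ (observed_join _ _))
    ext i
    exact Fin.append_left _ _ i
  right_inv ξ := by
    ext i
    refine Fin.addCases (m := k) (n := l + 1) (fun j => ?_) (fun j => ?_) i
    · exact Fin.append_left _ _ j
    · exact Fin.append_right _ _ j
  norm_map' p := by
    change ‖join p.fst p.snd‖ = ‖p‖
    rw [← sq_eq_sq₀ (norm_nonneg _) (norm_nonneg _), norm_join_sq, WithLp.prod_norm_sq_eq_of_L2]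

theorem continuous_join : Continuous fun p : E (l + 1) × E k => join p.2 p.1 := by
  have h : Continuous fun p : E (l + 1) × E k => (WithLp.toLp 2 (p.2, p.1) :
      WithLp 2 (E k × E (l + 1))) := (WithLp.prod_continuous_toLp 2 _ _).comp (by fun_prop)
  exact (joinIsometry k l).continuous.comp h

theorem continuous_observed : Continuous (observed : E (k + l + 1) → E (l + 1)) := by
  unfold observed
  refine (PiLp.continuous_toLp 2 _).comp (continuous_pi fun j => ?_)
  exact (EuclideanSpace.proj (𝕜 := ℝ) (Fin.natAdd k j : Fin (k + (l + 1)))).continuous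

theorem measurePreserving_join :
    MeasurePreserving (fun p : E (l + 1) × E k => join p.2 p.1) (volume.prod volume) volume :=
  ((joinIsometry k l).measurePreserving.comp (WithLp.volume_preserving_toLp (E k) (E (l + 1)))).comp
    Measure.measurePreserving_swap

end Join

/-- A pair of distributions of the hidden and the observed velocities whose joint distribution is
proportional to the downward flux of a reflection invariant distribution is stationary. -/
theorem IsPiecewiseSmooth.isStationary {k l : ℕ} {a : Fin (k + l) → ℝ} [∀ i, Fact (0 < a i)]
    {F : Torus a → ℝ} (hF : IsPiecewiseSmooth F) {c : ℝ} (hc : ∀ x, F x < c)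
    {μ : Measure (E k)} [IsProbabilityMeasure μ] {η : Measure (E (l + 1))}
    [hη : IsProbabilityMeasure η] {ν : Measure (E (k + l + 1))} (hν : IsReflectionInvariant ν)
    (C : ENNReal) (hjoin : (η.prod μ).map (fun p => join p.2 p.1) = C • downMeasure ν)
    (hlow : ∀ᵐ v ∂η, v ∈ lowerHalf l) : IsStationary F c μ η := by
  have := hν.isFiniteMeasure
  have hsf : SFinite (downMeasure ν) := by unfold downMeasure; infer_instance
  obtain ⟨hret, hmeas, hmap⟩ := hF.scatter_invariant hc hν
  set M := (η.prod μ).prod (uniform a) with hM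
  set D := (uniform a).prod (downMeasure ν) with hD
  -- Independent `v`, `w`, `x` give the pair `(x, (w, v))` a law proportional to the measure that
  -- scattering preserves.
  have hpres : MeasurePreserving (fun z : (E (l + 1) × E k) × Torus a =>
      (z.2, join z.1.2 z.1.1)) M (C • D) := by
    have h1 : MeasurePreserving (fun p : E (l + 1) × E k => join p.2 p.1) (η.prod μ)
        (C • downMeasure ν) := ⟨continuous_join.measurable, hjoin⟩
    have h2 := ((MeasurePreserving.id (uniform a)).prod h1).comp
      (Measure.measurePreserving_swap (μ := η.prod μ) (ν := uniform a))
    rw [Measure.prod_smul_right] at h2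
    exact h2
  have hac : (C • D) ≪ D := Measure.smul_absolutelyContinuous
  refine ⟨hη, hlow, ?_, fun Φ hΦ hsupp _ => ?_⟩
  · have h1 : ∀ᵐ z ∂M, ∃ V, Returns F c z.2 (join z.1.2 z.1.1) V :=
      hpres.quasiMeasurePreserving.ae (hac.ae_le hret)
    have h2 := Measure.ae_ae_of_ae_prod h1
    exact Measure.ae_ae_of_ae_prod h2
  · have hmeas' : AEMeasurable (fun z : (E (l + 1) × E k) × Torus a =>
        scatter F c z.2 (join z.1.2 z.1.1)) M :=
      AEMeasurable.comp_measurable (g := fun p : Torus a × E (k + l + 1) => scatter F c p.1 p.2)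
        (by rw [hpres.map_eq]; exact hmeas.mono_ac hac) hpres.measurable
    have hΨ : Continuous fun ξ : E (k + l + 1) => Φ (observed ξ) := hΦ.comp continuous_observed
    obtain ⟨B, hB⟩ := hΦ.bounded_above_of_compact_support hsupp
    have hint : Integrable (fun z : (E (l + 1) × E k) × Torus a =>
        Φ (observed (scatter F c z.2 (join z.1.2 z.1.1)))) M :=
      Integrable.of_bound (hΨ.measurable.comp_aemeasurable hmeas').aestronglyMeasurable B
        (Filter.Eventually.of_forall fun z => hB _)
    have hint2 := hint.integral_prod_left
    refine ⟨hint2.integral_prod_left, ?_⟩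
    have e1 : ∫ v, scatteringOp F c μ Φ v ∂η = ∫ z, Φ (observed (scatter F c z.2
        (join z.1.2 z.1.1))) ∂M := by
      rw [hM, integral_prod _ hint, integral_prod _ hint2]
      rfl
    -- The full outgoing velocity has the law of the full incoming one; taking observed components
    -- then gives back `η`.
    have e2 : M.map (fun z : (E (l + 1) × E k) × Torus a =>
        scatter F c z.2 (join z.1.2 z.1.1)) = (η.prod μ).map (fun p => join p.2 p.1) := by
      rw [hjoin, ← hmap, ← Measure.map_smul, ← hpres.map_eq,
        AEMeasurable.map_map_of_aemeasurable _ hpres.aemeasurable]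
      · rfl
      · rw [hpres.map_eq]
        exact hmeas.mono_ac hac
    rw [e1, ← integral_map hmeas' hΨ.aestronglyMeasurable, e2,
      integral_map continuous_join.aemeasurable hΨ.aestronglyMeasurable]
    simp only [observed_join]
    rw [integral_fun_fst, probReal_univ, one_smul]

theorem isProbabilityMeasure_normalized {X : Type} [MeasurableSpace X] {η : Measure X}
    (h0 : η univ ≠ 0) (h1 : η univ ≠ ⊤) : IsProbabilityMeasure (normalized η) :=
  ⟨by rw [normalized, Measure.smul_apply, smul_eq_mul, ENNReal.inv_mul_cancel h0 h1]⟩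

end

/-! ### Gaussian velocities and the Maxwell–Boltzmann measure. -/

section

/-- The Gaussian weight `exp (-|v|² / (2σ²))`. -/
def gaussianWeight {d : ℕ} (σ : ℝ) (v : E d) : ENNReal :=
  ENNReal.ofReal (Real.exp (-(1 / 2) * ‖v‖ ^ 2 / σ ^ 2))

theorem continuous_gaussianWeight {d : ℕ} (σ : ℝ) :
    Continuous (gaussianWeight σ : E d → ENNReal) := by
  unfold gaussianWeight
  exact ENNReal.continuous_ofReal.comp (by fun_prop)

/-- The integral of a non-integrable function is `0` by convention, while the Gaussian formula gives
a positive value. -/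
theorem integrable_exp_neg_mul_sq_norm {d : ℕ} {b : ℝ} (hb : 0 < b) :
    Integrable fun v : E d => Real.exp (-b * ‖v‖ ^ 2) := by
  by_contra h
  have h1 := integral_undef h
  rw [GaussianFourier.integral_rexp_neg_mul_sq_norm hb] at h1
  exact absurd h1 (Real.rpow_pos_of_pos (by positivity) _).ne'

theorem lintegral_exp_neg_mul_sq_norm {d : ℕ} {b : ℝ} (hb : 0 < b) :
    ∫⁻ v : E d, ENNReal.ofReal (Real.exp (-b * ‖v‖ ^ 2)) =
      ENNReal.ofReal ((Real.pi / b) ^ ((d : ℝ) / 2)) := by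
  rw [← ofReal_integral_eq_lintegral_ofReal (integrable_exp_neg_mul_sq_norm hb)
    (Filter.Eventually.of_forall fun v => (Real.exp_pos _).le),
    GaussianFourier.integral_rexp_neg_mul_sq_norm hb, finrank_euclideanSpace_fin]

theorem gaussianWeight_eq {d : ℕ} (σ : ℝ) (v : E d) :
    gaussianWeight σ v = ENNReal.ofReal (Real.exp (-(1 / (2 * σ ^ 2)) * ‖v‖ ^ 2)) := by
  rw [gaussianWeight]
  congr 2
  rw [one_div, one_div, mul_inv]
  ring

theorem lintegral_gaussianWeight {d : ℕ} {σ : ℝ} (hσ : 0 < σ) :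
    ∫⁻ v : E d, gaussianWeight σ v =
      ENNReal.ofReal ((2 * Real.pi * σ ^ 2) ^ ((d : ℝ) / 2)) := by
  simp only [gaussianWeight_eq]
  rw [lintegral_exp_neg_mul_sq_norm (by positivity)]
  congr 2
  field_simp

theorem lintegral_enorm_mul_gaussianWeight_lt_top {d : ℕ} {σ : ℝ} (hσ : 0 < σ) :
    ∫⁻ v : E d, gaussianWeight σ v * ‖v‖ₑ < ⊤ := by
  -- Half of the Gaussian exponent; the other half absorbs the factor `‖v‖` by means of `t + 1 ≤ exp
  -- t`.
  set b : ℝ := 1 / (4 * σ ^ 2) with hb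
  have hb0 : 0 < b := by positivity
  have hle : ∀ v : E d, gaussianWeight σ v * ‖v‖ₑ ≤
      ENNReal.ofReal (1 + 1 / b) * ENNReal.ofReal (Real.exp (-b * ‖v‖ ^ 2)) := by
    intro v
    rw [gaussianWeight_eq, ← ofReal_norm, ← ENNReal.ofReal_mul (Real.exp_pos _).le,
      ← ENNReal.ofReal_mul (by positivity)]
    refine ENNReal.ofReal_le_ofReal ?_
    have h1 : Real.exp (-(1 / (2 * σ ^ 2)) * ‖v‖ ^ 2) =
        Real.exp (-b * ‖v‖ ^ 2) * Real.exp (-(b * ‖v‖ ^ 2)) := by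
      rw [← Real.exp_add, hb]
      congr 1
      field_simp
      ring
    have h2 : ‖v‖ ≤ (1 + 1 / b) * Real.exp (b * ‖v‖ ^ 2) := by
      have h3 := Real.add_one_le_exp (b * ‖v‖ ^ 2)
      have h4 : (1 + 1 / b) * (b * ‖v‖ ^ 2 + 1) = b * ‖v‖ ^ 2 + 1 + ‖v‖ ^ 2 + 1 / b := by
        field_simp
        ring
      have h5 : (1 + 1 / b) * (b * ‖v‖ ^ 2 + 1) ≤ (1 + 1 / b) * Real.exp (b * ‖v‖ ^ 2) :=
        mul_le_mul_of_nonneg_left h3 (by positivity)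
      have h6 : 0 < 1 / b := by positivity
      nlinarith [sq_nonneg (‖v‖ - 1), mul_nonneg hb0.le (sq_nonneg ‖v‖)]
    rw [h1, mul_assoc, mul_comm]
    refine mul_le_mul_of_nonneg_right ?_ (Real.exp_pos _).le
    rw [Real.exp_neg, inv_mul_le_iff₀ (Real.exp_pos _), mul_comm]
    exact h2
  refine (lintegral_mono hle).trans_lt ?_
  rw [lintegral_const_mul' _ _ ENNReal.ofReal_ne_top, lintegral_exp_neg_mul_sq_norm hb0]
  exact ENNReal.mul_lt_top ENNReal.ofReal_lt_top ENNReal.ofReal_lt_top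

theorem volume_last_eq_zero (d : ℕ) :
    (volume : Measure (E (d + 1))) {v | v (Fin.last d) = 0} = 0 := by
  refine Measure.addHaar_submodule volume
    (LinearMap.ker (EuclideanSpace.proj (𝕜 := ℝ) (Fin.last d) : E (d + 1) →L[ℝ] ℝ).toLinearMap)
      fun h => ?_
  have h1 : (EuclideanSpace.single (Fin.last d) 1 : E (d + 1)) ∈ (⊤ : Submodule ℝ (E (d + 1))) :=
    Submodule.mem_top
  rw [← h, LinearMap.mem_ker] at h1
  simp at h1

theorem measurableSet_lowerHalf (l : ℕ) : MeasurableSet (lowerHalf l) :=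
  measurableSet_lt (Continuous.measurable (by fun_prop)) measurable_const

theorem isReflectionInvariant_gaussian (d : ℕ) {σ : ℝ} (hσ : 0 < σ) :
    IsReflectionInvariant ((volume : Measure (E (d + 1))).withDensity (gaussianWeight σ)) := by
  have hm : Measurable (gaussianWeight σ : E (d + 1) → ENNReal) :=
    (continuous_gaussianWeight σ).measurable
  refine ⟨⟨?_⟩, ?_, ?_, fun u hu => ?_⟩
  · rw [withDensity_apply _ MeasurableSet.univ, Measure.restrict_univ, lintegral_gaussianWeight hσ]
    exact ENNReal.ofReal_lt_top
  · rw [lintegral_withDensity_eq_lintegral_mul _ hm measurable_enorm]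
    exact lintegral_enorm_mul_gaussianWeight_lt_top hσ
  · exact (withDensity_absolutelyContinuous _ _).ae_le
      (measure_eq_zero_iff_ae_notMem.1 (volume_last_eq_zero d))
  · have hp := (reflectIsometry u hu).measurePreserving
    have hr : Measurable (reflect u) := hp.measurable
    refine Measure.ext_of_lintegral _ fun g hg => ?_
    have hg2 : Measurable fun v => g (reflect u v) := hg.comp hr
    rw [lintegral_map hg hr, lintegral_withDensity_eq_lintegral_mul _ hm hg2,
      lintegral_withDensity_eq_lintegral_mul _ hm hg, ← hp.lintegral_comp (hm.mul hg)]
    refine lintegral_congr fun v => ?_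
    have : gaussianWeight σ (reflect u v) = gaussianWeight σ v := by
      unfold gaussianWeight
      rw [show ‖reflect u v‖ = ‖v‖ from (reflectIsometry u hu).norm_map v]
    simp only [Pi.mul_apply]
    rw [show reflectIsometry u hu v = reflect u v from rfl, this]

theorem hiddenGaussian_eq (k : ℕ) {σ : ℝ} (hσ : 0 < σ) : hiddenGaussian k σ =
    (ENNReal.ofReal ((2 * Real.pi * σ ^ 2) ^ ((k : ℝ) / 2)))⁻¹ •
      (volume : Measure (E k)).withDensity (gaussianWeight σ) := by
  have h : 0 < (2 * Real.pi * σ ^ 2) ^ ((k : ℝ) / 2) := Real.rpow_pos_of_pos (by positivity) _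
  rw [hiddenGaussian, ← withDensity_smul _ (continuous_gaussianWeight σ).measurable]
  congr 1
  funext w
  rw [ENNReal.ofReal_div_of_pos h, Pi.smul_apply, smul_eq_mul, gaussianWeight, div_eq_mul_inv,
    mul_comm (ENNReal.ofReal (Real.exp _))]

theorem isProbabilityMeasure_hiddenGaussian (k : ℕ) {σ : ℝ} (hσ : 0 < σ) :
    IsProbabilityMeasure (hiddenGaussian k σ) := by
  have h : 0 < (2 * Real.pi * σ ^ 2) ^ ((k : ℝ) / 2) := Real.rpow_pos_of_pos (by positivity) _
  refine ⟨?_⟩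
  rw [hiddenGaussian_eq k hσ, Measure.smul_apply, withDensity_apply _ MeasurableSet.univ,
    Measure.restrict_univ, lintegral_gaussianWeight hσ, smul_eq_mul,
    ENNReal.inv_mul_cancel (by simpa using h) ENNReal.ofReal_ne_top]

/-- Truncation by `ENNReal.ofReal` kills the density where the last component is nonnegative, which
replaces the restriction to `lowerHalf l`. -/
theorem maxwellBoltzmann_eq (l : ℕ) (σ : ℝ) : maxwellBoltzmann l σ =
    downMeasure ((volume : Measure (E (l + 1))).withDensity (gaussianWeight σ)) := by
  have hl : Measurable fun v : E (l + 1) => ENNReal.ofReal (-v (Fin.last l)) :=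
    Measurable.ennreal_ofReal (Continuous.measurable (by fun_prop))
  rw [maxwellBoltzmann, downMeasure, ← withDensity_mul _ (continuous_gaussianWeight σ).measurable hl,
    ← withDensity_indicator (measurableSet_lowerHalf l)]
  congr 1
  funext v
  by_cases hv : v (Fin.last l) < 0
  · rw [indicator_of_mem (show v ∈ lowerHalf l from hv), Pi.mul_apply, gaussianWeight, ENNReal.ofReal_mul (abs_nonneg _),
      mul_comm, abs_of_neg hv]
  · rw [indicator_of_notMem (show v ∉ lowerHalf l from hv), Pi.mul_apply, ENNReal.ofReal_of_nonpos (by linarith), mul_zero]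

theorem maxwellBoltzmann_univ_ne_top (l : ℕ) {σ : ℝ} (hσ : 0 < σ) :
    maxwellBoltzmann l σ univ ≠ ⊤ := by
  have h := isReflectionInvariant_gaussian l hσ
  rw [maxwellBoltzmann_eq, downMeasure, withDensity_apply _ MeasurableSet.univ,
    Measure.restrict_univ]
  refine (lt_of_le_of_lt (lintegral_mono fun v => ?_) h.lintegral_enorm_lt_top).ne
  rw [← ofReal_norm]
  exact ENNReal.ofReal_le_ofReal ((neg_le_abs _).trans (PiLp.norm_apply_le v (Fin.last l)))

theorem maxwellBoltzmann_univ_ne_zero (l : ℕ) (σ : ℝ) : maxwellBoltzmann l σ univ ≠ 0 := by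
  have hm : Measurable fun v : E (l + 1) => ENNReal.ofReal
      (|v (Fin.last l)| * Real.exp (-(1 / 2) * ‖v‖ ^ 2 / σ ^ 2)) :=
    Measurable.ennreal_ofReal (Continuous.measurable (by fun_prop))
  rw [maxwellBoltzmann, withDensity_apply _ MeasurableSet.univ, Measure.restrict_univ]
  refine (setLIntegral_pos_iff hm).2 ?_ |>.ne'
  have hopen : IsOpen (lowerHalf l) := isOpen_lt (by fun_prop) continuous_const
  have hne : (lowerHalf l).Nonempty :=
    ⟨-EuclideanSpace.single (Fin.last l) 1, by simp [lowerHalf]⟩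
  refine (hopen.measure_pos volume hne).trans_le (measure_mono fun v hv => ⟨?_, hv⟩)
  have hv' : v (Fin.last l) < 0 := hv
  rw [Function.mem_support, ← pos_iff_ne_zero, ENNReal.ofReal_pos]
  exact mul_pos (abs_pos.2 hv'.ne) (Real.exp_pos _)

theorem ae_mem_lowerHalf_maxwellBoltzmann (l : ℕ) (σ : ℝ) :
    ∀ᵐ v ∂(maxwellBoltzmann l σ), v ∈ lowerHalf l :=
  (withDensity_absolutelyContinuous _ _).ae_le (ae_restrict_mem (measurableSet_lowerHalf l))

/-- The Gaussian weight of `(w, v)` is a product because squared norms add, and the flux factor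
involves only the last, observed component. -/
theorem map_join_gaussian (k l : ℕ) (σ : ℝ) :
    ((maxwellBoltzmann l σ).prod ((volume : Measure (E k)).withDensity (gaussianWeight σ))).map
      (fun p => join p.2 p.1) =
      downMeasure ((volume : Measure (E (k + l + 1))).withDensity (gaussianWeight σ)) := by
  have hl : ∀ d : ℕ, Measurable fun v : E (d + 1) => ENNReal.ofReal (-v (Fin.last d)) :=
    fun d => Measurable.ennreal_ofReal (Continuous.measurable (by fun_prop))
  have hg : ∀ d : ℕ, Measurable (gaussianWeight σ : E d → ENNReal) :=
    fun d => (continuous_gaussianWeight σ).measurable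
  have hp := measurePreserving_join (k := k) (l := l)
  rw [maxwellBoltzmann_eq, downMeasure, downMeasure, ← withDensity_mul _ (hg _) (hl _),
    ← withDensity_mul _ (hg _) (hl _), prod_withDensity ((hg _).mul (hl _)) (hg _)]
  refine Measure.ext_of_lintegral _ fun g hgm => ?_
  have hgj : Measurable fun p : E (l + 1) × E k => g (join p.2 p.1) := hgm.comp hp.measurable
  have hw : Measurable fun z : E (l + 1) × E k =>
      ((gaussianWeight σ : E (l + 1) → ENNReal) * fun v : E (l + 1) => ENNReal.ofReal (-v (Fin.last l))) z.1 *
        gaussianWeight σ z.2 :=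
    (((hg _).mul (hl _)).comp measurable_fst).mul ((hg _).comp measurable_snd)
  rw [lintegral_map hgm hp.measurable, lintegral_withDensity_eq_lintegral_mul _ hw hgj,
    lintegral_withDensity_eq_lintegral_mul _ ((hg _).mul (hl _)) hgm,
    ← hp.lintegral_comp (((hg _).mul (hl _)).mul hgm)]
  refine lintegral_congr fun p => ?_
  simp only [Pi.mul_apply]
  congr 1
  have : gaussianWeight σ (join p.2 p.1) = gaussianWeight σ p.1 * gaussianWeight σ p.2 := by
    unfold gaussianWeight
    rw [← ENNReal.ofReal_mul (Real.exp_pos _).le, ← Real.exp_add, norm_join_sq]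
    congr 2
    ring
  rw [this, join_last]
  ring

theorem IsPiecewiseSmooth.isStationary_maxwellBoltzmann {k l : ℕ} {a : Fin (k + l) → ℝ}
    [∀ i, Fact (0 < a i)] {F : Torus a → ℝ} (hF : IsPiecewiseSmooth F) {c : ℝ}
    (hc : ∀ x, F x < c) {σ : ℝ} (hσ : 0 < σ) :
    IsStationary F c (hiddenGaussian k σ) (normalized (maxwellBoltzmann l σ)) := by
  have h0 := maxwellBoltzmann_univ_ne_zero l σ
  have h1 := maxwellBoltzmann_univ_ne_top l hσ
  have := isProbabilityMeasure_hiddenGaussian k hσ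
  have := isProbabilityMeasure_normalized h0 h1
  have hfin : IsFiniteMeasure (maxwellBoltzmann l σ) := ⟨h1.lt_top⟩
  have hg := (isReflectionInvariant_gaussian (k + l) hσ)
  -- The constant is the product of the two normalizing factors.
  refine hF.isStationary hc hg ((maxwellBoltzmann l σ univ)⁻¹ *
    (ENNReal.ofReal ((2 * Real.pi * σ ^ 2) ^ ((k : ℝ) / 2)))⁻¹) ?_ ?_
  · rw [normalized, hiddenGaussian_eq k hσ, Measure.prod_smul_left, Measure.prod_smul_right,
      smul_smul, Measure.map_smul, map_join_gaussian]
  · exact (Measure.smul_absolutelyContinuous (c := (maxwellBoltzmann l σ univ)⁻¹)).ae_le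
      (ae_mem_lowerHalf_maxwellBoltzmann l σ)

end

/-! ### Surface measure on the sphere and the cosine law. -/

section

/-- The Euclidean surface measure of the unit sphere, as a measure on `ℝ^d`. -/
def sphereMeasure (d : ℕ) : Measure (E d) := (volume : Measure (E d)).toSphere.map Subtype.val

instance (d : ℕ) : IsFiniteMeasure (sphereMeasure d) := by
  unfold sphereMeasure
  infer_instance

theorem measurable_inv_norm_smul {d : ℕ} : Measurable fun v : E d => ‖v‖⁻¹ • v :=
  measurable_norm.inv.smul measurable_id

/-- The surface measure is the radial projection of the volume of the unit ball. -/
theorem sphereMeasure_eq (d : ℕ) : sphereMeasure d =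
    (d : ENNReal) • (volume.restrict (Metric.ball (0 : E d) 1 \ {0})).map fun v => ‖v‖⁻¹ • v := by
  ext B hB
  have hN := measurable_inv_norm_smul (d := d)
  have hBm : MeasurableSet ((Subtype.val : Metric.sphere (0 : E d) 1 → E d) ⁻¹' B) :=
    measurable_subtype_coe hB
  rw [sphereMeasure, Measure.map_apply measurable_subtype_coe hB, Measure.toSphere_apply' _ hBm,
    Measure.smul_apply, Measure.map_apply hN hB, Measure.restrict_apply (hN hB),
    finrank_euclideanSpace_fin, smul_eq_mul]
  congr 2
  ext v
  simp only [mem_smul, mem_image, mem_preimage, mem_inter_iff, mem_sdiff, Metric.mem_ball,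
    dist_zero_right, mem_singleton_iff]
  constructor
  · rintro ⟨r, ⟨hr0, hr1⟩, _, ⟨u, hu, rfl⟩, rfl⟩
    have hnu : ‖(u : E d)‖ = 1 := by simp
    have hnr : ‖r • (u : E d)‖ = r := by rw [norm_smul, hnu, mul_one, Real.norm_of_nonneg hr0.le]
    rw [hnr, inv_smul_smul₀ hr0.ne']
    refine ⟨hu, hr1, fun h => ?_⟩
    rw [h, norm_zero] at hnr
    exact hr0.ne hnr
  · rintro ⟨hvB, hv1, hv0⟩
    have hpos : 0 < ‖v‖ := norm_pos_iff.2 hv0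
    refine ⟨‖v‖, ⟨hpos, hv1⟩, _, ⟨⟨‖v‖⁻¹ • v, ?_⟩, hvB, rfl⟩, smul_inv_smul₀ hpos.ne' v⟩
    simp [norm_smul, hpos.ne']

/-- A linear isometry preserves volume on the punctured ball and commutes with radial projection. -/
theorem sphereMeasure_map_isometry {d : ℕ} (U : E d ≃ₗᵢ[ℝ] E d) :
    (sphereMeasure d).map U = sphereMeasure d := by
  have hN := measurable_inv_norm_smul (d := d)
  have hU : Measurable U := U.continuous.measurable
  have hpre : U ⁻¹' (Metric.ball (0 : E d) 1 \ {0}) = Metric.ball (0 : E d) 1 \ {0} := by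
    ext v
    simp
  have hp := U.measurePreserving.restrict_preimage
    (s := Metric.ball (0 : E d) 1 \ {0}) (measurableSet_ball.diff (measurableSet_singleton 0))
  rw [hpre] at hp
  have hcomm : (U ∘ fun v : E d => ‖v‖⁻¹ • v) = (fun v : E d => ‖v‖⁻¹ • v) ∘ U := by
    funext v
    simp
  rw [sphereMeasure_eq, Measure.map_smul, Measure.map_map hU hN, hcomm, ← Measure.map_map hN hU,
    hp.map_eq]

theorem sphereMeasure_last_eq_zero (d : ℕ) :
    ∀ᵐ v ∂(sphereMeasure (d + 1)), v (Fin.last d) ≠ 0 := by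
  have hN := measurable_inv_norm_smul (d := d + 1)
  have hm : MeasurableSet {v : E (d + 1) | v (Fin.last d) ≠ 0} :=
    (measurableSet_eq_fun (Continuous.measurable (by fun_prop)) measurable_const).compl
  rw [sphereMeasure_eq]
  refine Measure.smul_absolutelyContinuous.ae_le ((ae_map_iff hN.aemeasurable hm).2 ?_)
  have h0 : ∀ᵐ v : E (d + 1), v (Fin.last d) ≠ 0 :=
    measure_eq_zero_iff_ae_notMem.1 (volume_last_eq_zero d)
  filter_upwards [ae_restrict_of_ae h0] with v hv
  have hv0 : v ≠ 0 := by
    rintro rfl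
    exact hv rfl
  rw [PiLp.smul_apply, smul_eq_mul]
  exact mul_ne_zero (inv_ne_zero (norm_ne_zero_iff.2 hv0)) hv

theorem lintegral_enorm_sphereMeasure_lt_top (d : ℕ) : ∫⁻ v, ‖v‖ₑ ∂(sphereMeasure d) < ⊤ := by
  rw [sphereMeasure, lintegral_map measurable_enorm measurable_subtype_coe]
  have : ∀ u : Metric.sphere (0 : E d) 1, ‖(u : E d)‖ₑ = 1 := by
    intro u
    rw [← ofReal_norm, mem_sphere_zero_iff_norm.1 u.2, ENNReal.ofReal_one]
  simp only [this]
  rw [lintegral_one]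
  exact measure_lt_top _ _

theorem cosineMeasure_eq (l : ℕ) : cosineMeasure l = downMeasure (sphereMeasure (l + 1)) := by
  rw [cosineMeasure, downMeasure, hemisphereMeasure, ← withDensity_indicator
    (measurableSet_lowerHalf l), sphereMeasure]
  congr 1
  funext v
  by_cases hv : v (Fin.last l) < 0
  · rw [indicator_of_mem (show v ∈ lowerHalf l from hv), abs_of_neg hv]
  · rw [indicator_of_notMem (show v ∉ lowerHalf l from hv), ENNReal.ofReal_of_nonpos (by linarith)]

theorem ae_mem_lowerHalf_cosineMeasure (l : ℕ) : ∀ᵐ v ∂(cosineMeasure l), v ∈ lowerHalf l :=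
  (withDensity_absolutelyContinuous _ _).ae_le (ae_restrict_mem (measurableSet_lowerHalf l))

/-- Adjoining no hidden velocities is a linear isometry. -/
def joinZero (l : ℕ) : E (l + 1) ≃ₗᵢ[ℝ] E (0 + l + 1) :=
  LinearIsometry.toLinearIsometryEquiv
    { toFun := fun v => join (0 : E 0) v
      map_add' := fun v w => by
        have := (joinIsometry 0 l).map_add (WithLp.toLp 2 (0, v)) (WithLp.toLp 2 (0, w))
        rw [← WithLp.toLp_add, Prod.mk_add_mk, add_zero] at this
        exact this
      map_smul' := fun r v => by
        have := (joinIsometry 0 l).map_smul r (WithLp.toLp 2 (0, v))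
        rw [← WithLp.toLp_smul, Prod.smul_mk, smul_zero] at this
        exact this
      norm_map' := fun v => by
        change ‖join (0 : E 0) v‖ = ‖v‖
        rw [← sq_eq_sq₀ (norm_nonneg _) (norm_nonneg _), norm_join_sq]
        simp }
    (by simp)

theorem joinZero_apply (l : ℕ) (v : E (l + 1)) : joinZero l v = join (0 : E 0) v := rfl

/-- Scattering with `k = 0` lives in `E (0 + l + 1)`, so the sphere is transported by `joinZero`. A
reflection there is conjugate to some isometry of `E (l + 1)`, which is why invariance under all
isometries is needed. -/
theorem isReflectionInvariant_sphere (l : ℕ) :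
    IsReflectionInvariant ((sphereMeasure (l + 1)).map (joinZero l)) := by
  have hJ : Measurable (joinZero l) := (joinZero l).continuous.measurable
  refine ⟨inferInstance, ?_, ?_, fun u hu => ?_⟩
  · rw [lintegral_map measurable_enorm hJ]
    refine lt_of_eq_of_lt (lintegral_congr fun v => ?_) (lintegral_enorm_sphereMeasure_lt_top (l + 1))
    rw [← ofReal_norm, ← ofReal_norm, LinearIsometryEquiv.norm_map]
  · have hm : MeasurableSet {v : E (0 + l + 1) | v (Fin.last (0 + l)) ≠ 0} :=
      (measurableSet_eq_fun (Continuous.measurable (by fun_prop)) measurable_const).compl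
    refine (ae_map_iff hJ.aemeasurable hm).2 ?_
    filter_upwards [sphereMeasure_last_eq_zero l] with v hv
    rw [joinZero_apply, join_last]
    exact hv
  · set R := reflectIsometry u hu
    have hR : Measurable R := R.continuous.measurable
    change Measure.map R _ = _
    set U := ((joinZero l).trans R).trans (joinZero l).symm
    have hUJ : R ∘ joinZero l = joinZero l ∘ U := by
      funext v
      simp [U]
    rw [Measure.map_map hR hJ, hUJ, ← Measure.map_map hJ U.continuous.measurable,
      sphereMeasure_map_isometry]

theorem downMeasure_map_joinZero (l : ℕ) (ρ : Measure (E (l + 1))) :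
    downMeasure (ρ.map (joinZero l)) = (downMeasure ρ).map (joinZero l) := by
  have hJ : Measurable (joinZero l) := (joinZero l).continuous.measurable
  have hl : ∀ d : ℕ, Measurable fun v : E (d + 1) => ENNReal.ofReal (-v (Fin.last d)) :=
    fun d => Measurable.ennreal_ofReal (Continuous.measurable (by fun_prop))
  refine Measure.ext_of_lintegral _ fun g hg => ?_
  have hgJ : Measurable fun v => g (joinZero l v) := hg.comp hJ
  rw [lintegral_map hg hJ, downMeasure, downMeasure,
    lintegral_withDensity_eq_lintegral_mul _ (hl _) hg,
    lintegral_withDensity_eq_lintegral_mul _ (hl _) hgJ,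
    lintegral_map ((hl _).mul hg) hJ]
  refine lintegral_congr fun v => ?_
  simp only [Pi.mul_apply, joinZero_apply, join_last]

theorem measurePreserving_horiz_last (l : ℕ) :
    MeasurePreserving (fun v : E (l + 1) => (horiz v, v (Fin.last l))) volume
      (volume.prod volume) := by
  have h1 := volume_preserving_piFinSuccAbove (fun _ : Fin (l + 1) => ℝ) (Fin.last l)
  have h2 := (MeasurePreserving.id (volume : Measure ℝ)).prod (PiLp.volume_preserving_toLp (Fin l))
  have h3 := (Measure.measurePreserving_swap.comp (h2.comp h1)).comp
    (PiLp.volume_preserving_ofLp (Fin (l + 1)))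
  have h4 : (fun v : E (l + 1) => (horiz v, v (Fin.last l))) =
      (Prod.swap ∘ Prod.map id (WithLp.toLp 2) ∘
        MeasurableEquiv.piFinSuccAbove (fun _ => ℝ) (Fin.last l)) ∘ WithLp.ofLp := by
    funext v
    refine Prod.ext ?_ rfl
    ext i
    simp [horiz, Fin.init]
  rw [h4]
  exact h3

theorem norm_sq_eq_horiz_last {l : ℕ} (v : E (l + 1)) :
    ‖v‖ ^ 2 = ‖horiz v‖ ^ 2 + v (Fin.last l) ^ 2 := by
  rw [EuclideanSpace.norm_sq_eq, EuclideanSpace.norm_sq_eq, Fin.sum_univ_castSucc]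
  simp [horiz]

/-- The substitution `s = √(m² + z²)` on the half-line `z < 0`. -/
theorem lintegral_sqrt_substitution {m : ℝ} (hm : 0 ≤ m) (φ : ℝ → ENNReal) :
    ∫⁻ z, ENNReal.ofReal (-(z / √(m ^ 2 + z ^ 2))) * φ √(m ^ 2 + z ^ 2) =
      ∫⁻ s in Ioi m, φ s := by
  have himg : (fun z : ℝ => √(m ^ 2 + z ^ 2)) '' Iio 0 = Ioi m := by
    ext s
    constructor
    · rintro ⟨z, hz, rfl⟩
      exact Real.lt_sqrt_of_sq_lt (by nlinarith [sq_pos_of_neg (mem_Iio.1 hz)])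
    · intro hs
      have hs' : m < s := hs
      have h1 : 0 < s ^ 2 - m ^ 2 := by nlinarith
      refine ⟨-√(s ^ 2 - m ^ 2), by simpa using h1, ?_⟩
      simp only [neg_sq]
      rw [Real.sq_sqrt h1.le, add_sub_cancel, Real.sqrt_sq (hm.trans hs'.le)]
  have hder : ∀ z ∈ Iio (0 : ℝ), HasDerivWithinAt (fun z : ℝ => √(m ^ 2 + z ^ 2))
      (z / √(m ^ 2 + z ^ 2)) (Iio 0) z := by
    intro z hz
    have hpos : 0 < m ^ 2 + z ^ 2 := by nlinarith [sq_pos_of_neg (mem_Iio.1 hz), sq_nonneg m]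
    have := (((hasDerivAt_pow 2 z).const_add (m ^ 2)).sqrt hpos.ne').hasDerivWithinAt (s := Iio 0)
    convert! this using 1
    field_simp
    norm_num [mul_comm]
  have hinj : InjOn (fun z : ℝ => √(m ^ 2 + z ^ 2)) (Iio 0) := by
    intro z hz w hw h
    have h1 := congrArg (· ^ 2) h
    simp only at h1
    rw [Real.sq_sqrt (by positivity), Real.sq_sqrt (by positivity)] at h1
    have hz' : z < 0 := hz
    have hw' : w < 0 := hw
    nlinarith
  rw [← himg, lintegral_image_eq_lintegral_abs_deriv_mul measurableSet_Iio hder hinj,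
    ← lintegral_indicator measurableSet_Iio]
  refine lintegral_congr fun z => ?_
  -- The derivative is negative on the half-line, so its absolute value is the weight; for `z ≥ 0`
  -- the weight is truncated to `0`.
  by_cases hz : z < 0
  · rw [indicator_of_mem (show z ∈ Iio 0 from hz), abs_of_nonpos]
    exact div_nonpos_of_nonpos_of_nonneg hz.le (Real.sqrt_nonneg _)
  · rw [indicator_of_notMem (show z ∉ Iio 0 from hz), ENNReal.ofReal_of_nonpos, zero_mul]
    rw [neg_nonpos]
    exact div_nonneg (not_lt.1 hz) (Real.sqrt_nonneg _)

end

/-! ### Projection of the cosine law to Lebesgue measure on the ball. -/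

section

/-- The image of the cosine measure under the projection of the hemisphere to the ball is
proportional to Lebesgue measure. -/
theorem exists_map_horiz_cosineMeasure (l : ℕ) : ∃ K : ENNReal, K ≠ 0 ∧ K ≠ ⊤ ∧
    (cosineMeasure l).map horiz = K • volume.restrict (Metric.ball (0 : E l) 1) := by
  -- This is the integral of `s ^ l` over `(0, 1)`, in the form produced by the scaling formula for
  -- volume. Only its being finite and non-zero matters.
  set κ : ENNReal := ∫⁻ s in Ioo (0 : ℝ) 1, ENNReal.ofReal |((s⁻¹) ^ l)⁻¹| with hκ
  have hκm : Measurable fun s : ℝ => ENNReal.ofReal |((s⁻¹) ^ l)⁻¹| := by fun_prop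
  have hκ0 : κ ≠ 0 := by
    refine (pos_iff_ne_zero.1 ((setLIntegral_pos_iff hκm).2 ?_))
    have : (0 : ENNReal) < volume (Ioo (0 : ℝ) 1) := by simp
    refine this.trans_le (measure_mono fun s hs => ⟨?_, hs⟩)
    have := hs.1
    rw [Function.mem_support, ← pos_iff_ne_zero, ENNReal.ofReal_pos]
    positivity
  have hκt : κ ≠ ⊤ := by
    have hle : κ ≤ ∫⁻ s in Ioo (0 : ℝ) 1, 1 := by
      refine setLIntegral_mono measurable_const fun s hs => ?_
      rw [inv_pow, inv_inv, ENNReal.ofReal_le_one, abs_of_nonneg (pow_nonneg hs.1.le _)]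
      exact pow_le_one₀ hs.1.le hs.2.le
    refine (hle.trans_lt ?_).ne
    simp
  refine ⟨((l + 1 : ℕ) : ENNReal) * κ, mul_ne_zero (by simp) hκ0,
    ENNReal.mul_ne_top (ENNReal.natCast_ne_top _) hκt, ?_⟩
  ext B hB
  have hN := measurable_inv_norm_smul (d := l + 1)
  have hh := (continuous_horiz (n := l)).measurable
  have hl : Measurable fun v : E (l + 1) => ENNReal.ofReal (-v (Fin.last l)) :=
    Measurable.ennreal_ofReal (Continuous.measurable (by fun_prop))
  -- The cone over `B ∩ ball`: its slice at height `s` is a dilate by `s`, of volume `s ^ l` times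
  -- that of the base.
  set A : Set (E l × ℝ) := {p | p.2 ∈ Ioo (0 : ℝ) 1 ∧ p.2⁻¹ • p.1 ∈ B ∩ Metric.ball 0 1} with hA
  have hAm : MeasurableSet A := by
    have h1 : Measurable fun p : E l × ℝ => p.2⁻¹ • p.1 := measurable_snd.inv.smul measurable_fst
    exact (measurable_snd measurableSet_Ioo).inter (h1 (hB.inter measurableSet_ball))
  have hAvol : (volume.prod volume) A = κ * volume (B ∩ Metric.ball (0 : E l) 1) := by
    rw [Measure.prod_apply_symm hAm, hκ, ← lintegral_mul_const _ hκm,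
      ← lintegral_indicator measurableSet_Ioo]
    refine lintegral_congr fun s => ?_
    by_cases hs : s ∈ Ioo (0 : ℝ) 1
    · rw [indicator_of_mem hs]
      have := Measure.addHaar_preimage_smul volume (inv_ne_zero hs.1.ne')
        (B ∩ Metric.ball (0 : E l) 1)
      rw [finrank_euclideanSpace_fin] at this
      rw [← this]
      congr 1
      ext h
      exact ⟨fun hp => hp.2, fun hp => ⟨hs, hp⟩⟩
    · rw [indicator_of_notMem hs]
      have : (fun h : E l => (h, s)) ⁻¹' A = ∅ := eq_empty_of_forall_notMem fun h hp => hs hp.1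
      rw [this, measure_empty]
  let φ : E l → ℝ → ENNReal := fun h s =>
    (Iio (1 : ℝ)).indicator 1 s * B.indicator 1 (s⁻¹ • h)
  -- The cosine-weighted indicator of the unit ball points that radially project over `B`, in
  -- coordinates `(h, z)` with `s = ‖v‖`. As the cosine is `|ds/dz|`, integrating out `z` leaves
  -- Lebesgue measure of the cone `A`.
  let Γ : E l × ℝ → ENNReal := fun p => ENNReal.ofReal (-(p.2 / √(‖p.1‖ ^ 2 + p.2 ^ 2))) *
    φ p.1 √(‖p.1‖ ^ 2 + p.2 ^ 2)
  have hsqrt : Measurable fun p : E l × ℝ => √(‖p.1‖ ^ 2 + p.2 ^ 2) :=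
    Continuous.measurable (by fun_prop)
  have hΓm : Measurable Γ := by
    have h1 : Measurable fun p : E l × ℝ => (√(‖p.1‖ ^ 2 + p.2 ^ 2))⁻¹ • p.1 :=
      hsqrt.inv.smul measurable_fst
    have h2 : Measurable fun p : E l × ℝ => -(p.2 / √(‖p.1‖ ^ 2 + p.2 ^ 2)) :=
      (measurable_snd.div hsqrt).neg
    exact h2.ennreal_ofReal.mul
      (((measurable_const.indicator measurableSet_Iio : Measurable
        ((Iio (1 : ℝ)).indicator (1 : ℝ → ENNReal))).comp hsqrt).mul
        ((measurable_const.indicator hB : Measurable (B.indicator (1 : E l → ENNReal))).comp h1))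
  have hslice : ∀ h : E l, ∫⁻ z, Γ (h, z) = volume (Prod.mk h ⁻¹' A) := by
    intro h
    have hm : MeasurableSet (Prod.mk h ⁻¹' A) := measurable_prodMk_left hAm
    rw [lintegral_sqrt_substitution (norm_nonneg h) (φ h), ← lintegral_indicator measurableSet_Ioi,
      ← lintegral_indicator_one hm]
    refine lintegral_congr fun s => ?_
    have hball : 0 < s → (s⁻¹ • h ∈ Metric.ball (0 : E l) 1 ↔ ‖h‖ < s) := by
      intro hs
      rw [mem_ball_zero_iff, norm_smul, norm_inv, Real.norm_of_nonneg hs.le, inv_mul_lt_iff₀ hs,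
        mul_one]
    by_cases hs : s ∈ Prod.mk h ⁻¹' A
    · obtain ⟨⟨h0, h1⟩, h2, h3⟩ := hs
      rw [indicator_of_mem (show s ∈ Prod.mk h ⁻¹' A from ⟨⟨h0, h1⟩, h2, h3⟩),
        indicator_of_mem (show s ∈ Ioi ‖h‖ from (hball h0).1 h3)]
      change (Iio (1 : ℝ)).indicator (1 : ℝ → ENNReal) s * B.indicator 1 (s⁻¹ • h) = _
      rw [indicator_of_mem (show s ∈ Iio 1 from h1), indicator_of_mem h2]
      simp
    · rw [indicator_of_notMem hs]
      by_cases h1 : s ∈ Ioi ‖h‖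
      · rw [indicator_of_mem h1]
        change (Iio (1 : ℝ)).indicator (1 : ℝ → ENNReal) s * B.indicator 1 (s⁻¹ • h) = _
        have h0 : 0 < s := (norm_nonneg h).trans_lt h1
        by_cases h2 : s < 1
        · rw [indicator_of_notMem (s := B), mul_zero]
          exact fun h3 => hs ⟨⟨h0, h2⟩, h3, (hball h0).2 h1⟩
        · rw [indicator_of_notMem (show s ∉ Iio (1 : ℝ) from h2), zero_mul]
      · rw [indicator_of_notMem h1]
  have hmain : cosineMeasure l (horiz ⁻¹' B) =
      ((l + 1 : ℕ) : ENNReal) * ∫⁻ v : E (l + 1), Γ (horiz v, v (Fin.last l)) := by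
    have hg : Measurable ((horiz ⁻¹' B).indicator fun v : E (l + 1) =>
        ENNReal.ofReal (-v (Fin.last l))) := hl.indicator (hh hB)
    rw [cosineMeasure_eq, downMeasure, withDensity_apply _ (hh hB), ← lintegral_indicator (hh hB),
      sphereMeasure_eq, lintegral_smul_measure, lintegral_map hg hN, smul_eq_mul,
      ← lintegral_indicator (measurableSet_ball.diff (measurableSet_singleton 0))]
    congr 1
    refine lintegral_congr fun v => ?_
    have hnorm : √(‖horiz v‖ ^ 2 + v (Fin.last l) ^ 2) = ‖v‖ := by
      rw [← norm_sq_eq_horiz_last, Real.sqrt_sq (norm_nonneg _)]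
    simp only [Γ, φ, hnorm]
    by_cases hv0 : v = 0
    · subst hv0
      simp
    have hNl : (‖v‖⁻¹ • v) (Fin.last l) = v (Fin.last l) / ‖v‖ := by
      rw [PiLp.smul_apply, smul_eq_mul, div_eq_inv_mul]
    have hNh : horiz (‖v‖⁻¹ • v) = ‖v‖⁻¹ • horiz v := rfl
    by_cases hv1 : ‖v‖ < 1
    · have hmem : v ∈ Metric.ball (0 : E (l + 1)) 1 \ {0} := ⟨by simpa using hv1, hv0⟩
      rw [indicator_of_mem hmem, indicator_of_mem (show ‖v‖ ∈ Iio (1 : ℝ) from hv1)]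
      by_cases hB' : ‖v‖⁻¹ • horiz v ∈ B
      · rw [indicator_of_mem (show ‖v‖⁻¹ • v ∈ horiz ⁻¹' B from hB'), indicator_of_mem hB', hNl]
        simp
      · rw [indicator_of_notMem (show ‖v‖⁻¹ • v ∉ horiz ⁻¹' B from hB'), indicator_of_notMem hB']
        simp
    · have hmem : v ∉ Metric.ball (0 : E (l + 1)) 1 \ {0} := fun h => hv1 (by simpa using h.1)
      rw [indicator_of_notMem hmem, indicator_of_notMem (show ‖v‖ ∉ Iio (1 : ℝ) from hv1), zero_mul,
        mul_zero]
  have hp := measurePreserving_horiz_last l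
  rw [Measure.map_apply hh hB, hmain, hp.lintegral_comp hΓm, lintegral_prod _ hΓm.aemeasurable]
  simp only [hslice]
  rw [← Measure.prod_apply hAm, hAvol, Measure.smul_apply, Measure.restrict_apply hB, smul_eq_mul,
    mul_assoc]

theorem cosineMeasure_univ_ne_zero (l : ℕ) : cosineMeasure l univ ≠ 0 := by
  obtain ⟨K, h0, -, h⟩ := exists_map_horiz_cosineMeasure l
  have h1 := congrArg (fun ρ => ρ univ) h
  simp only [Measure.map_apply continuous_horiz.measurable MeasurableSet.univ, preimage_univ,
    Measure.smul_apply, Measure.restrict_apply_univ, smul_eq_mul] at h1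
  rw [h1]
  exact mul_ne_zero h0 (Metric.measure_ball_pos _ _ one_pos).ne'

theorem cosineMeasure_univ_ne_top (l : ℕ) : cosineMeasure l univ ≠ ⊤ := by
  obtain ⟨K, -, h0, h⟩ := exists_map_horiz_cosineMeasure l
  have h1 := congrArg (fun ρ => ρ univ) h
  simp only [Measure.map_apply continuous_horiz.measurable MeasurableSet.univ, preimage_univ,
    Measure.smul_apply, Measure.restrict_apply_univ, smul_eq_mul] at h1
  rw [h1]
  exact ENNReal.mul_ne_top h0 measure_ball_lt_top.ne

theorem map_horiz_normalized_cosineMeasure (l : ℕ) :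
    (normalized (cosineMeasure l)).map horiz =
      normalized (volume.restrict (Metric.ball (0 : E l) 1)) := by
  obtain ⟨K, h0, h1, h⟩ := exists_map_horiz_cosineMeasure l
  have h2 : cosineMeasure l univ = K * volume.restrict (Metric.ball (0 : E l) 1) univ := by
    have := congrArg (fun ρ => ρ univ) h
    simpa [Measure.map_apply continuous_horiz.measurable MeasurableSet.univ] using this
  rw [normalized, normalized, Measure.map_smul, h, smul_smul, h2,
    ENNReal.mul_inv (Or.inl h0) (Or.inl h1), mul_right_comm, ENNReal.inv_mul_cancel h0 h1, one_mul]

theorem bijOn_horiz_hemisphere (l : ℕ) :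
    BijOn horiz (hemisphere l) (Metric.ball (0 : E l) 1) := by
  have hsq : ∀ v ∈ hemisphere l, ‖horiz v‖ ^ 2 + v (Fin.last l) ^ 2 = 1 := by
    intro v hv
    rw [← norm_sq_eq_horiz_last, mem_sphere_zero_iff_norm.1 hv.1, one_pow]
  refine ⟨fun v hv => ?_, fun v hv w hw h => ?_, fun x hx => ?_⟩
  · have h1 := hsq v hv
    have h2 : v (Fin.last l) < 0 := hv.2
    rw [mem_ball_zero_iff]
    nlinarith [norm_nonneg (horiz v)]
  · have h1 := hsq v hv
    have h2 := hsq w hw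
    rw [h] at h1
    have h3 : v (Fin.last l) < 0 := hv.2
    have h4 : w (Fin.last l) < 0 := hw.2
    ext i
    induction i using Fin.lastCases with
    | last => nlinarith
    | cast i => exact congrArg (fun x : E l => x i) h
  · rw [mem_ball_zero_iff] at hx
    have hpos : 0 < 1 - ‖x‖ ^ 2 := by nlinarith [norm_nonneg x]
    let v : E (l + 1) := WithLp.toLp 2
      (Fin.snoc (α := fun _ => ℝ) (fun i => x i) (-√(1 - ‖x‖ ^ 2)))
    have hvh : horiz v = x := by
      ext i
      simp [v, horiz]
    have hvl : v (Fin.last l) = -√(1 - ‖x‖ ^ 2) := by simp [v]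
    refine ⟨v, ⟨?_, ?_⟩, hvh⟩
    · rw [mem_sphere_zero_iff_norm, ← sq_eq_sq₀ (norm_nonneg _) zero_le_one, norm_sq_eq_horiz_last,
        hvh, hvl, neg_sq, Real.sq_sqrt hpos.le]
      ring
    · change v (Fin.last l) < 0
      rw [hvl, neg_lt_zero]
      exact Real.sqrt_pos.2 hpos

theorem IsPiecewiseSmooth.isStationary_cosineMeasure {l : ℕ} {a : Fin (0 + l) → ℝ}
    [∀ i, Fact (0 < a i)] {F : Torus a → ℝ} (hF : IsPiecewiseSmooth F) {c : ℝ}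
    (hc : ∀ x, F x < c) (μ : Measure (E 0)) [IsProbabilityMeasure μ] :
    IsStationary F c μ (normalized (cosineMeasure l)) := by
  have := isProbabilityMeasure_normalized (cosineMeasure_univ_ne_zero l)
    (cosineMeasure_univ_ne_top l)
  have hJ : Measurable (joinZero l) := (joinZero l).continuous.measurable
  refine hF.isStationary hc (isReflectionInvariant_sphere l) (cosineMeasure l univ)⁻¹ ?_ ?_
  -- `E 0` is a single point, so the hidden law plays no role.
  · have h1 : (fun p : E (l + 1) × E 0 => join p.2 p.1) = joinZero l ∘ Prod.fst := by
      funext p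
      rw [Function.comp_apply, joinZero_apply, Subsingleton.elim p.2 0]
    rw [h1, ← Measure.map_map hJ measurable_fst, Measure.map_fst_prod, measure_univ, one_smul,
      normalized, Measure.map_smul, downMeasure_map_joinZero, ← cosineMeasure_eq]
  · exact (Measure.smul_absolutelyContinuous (c := (cosineMeasure l univ)⁻¹)).ae_le
      (ae_mem_lowerHalf_cosineMeasure l)

end

end RandomBilliard

end

/-- Finiteness and non-vanishing of the two measures are contained in `IsStationary`: if the total
mass of `η` is `0` or `⊤`, then `normalized η` has total mass `0` and is not a probability measure.
-/
theorem proposition3p1 {k l : ℕ} (a : Fin (k + l) → ℝ) [∀ i, Fact (0 < a i)]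
    (F : RandomBilliard.Torus a → ℝ) (hF : RandomBilliard.IsPiecewiseSmooth F)
    (c : ℝ) (hc : ∀ x, F x < c) :
    (k = 0 → ∀ (μ : Measure (RandomBilliard.E k)) [IsProbabilityMeasure μ],
      RandomBilliard.IsStationary F c μ
        (RandomBilliard.normalized (RandomBilliard.cosineMeasure l)) ∧
      Set.BijOn RandomBilliard.horiz (RandomBilliard.hemisphere l)
        (Metric.ball (0 : RandomBilliard.E l) 1) ∧
      (RandomBilliard.normalized (RandomBilliard.cosineMeasure l)).map RandomBilliard.horiz =
        RandomBilliard.normalized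
          (volume.restrict (Metric.ball (0 : RandomBilliard.E l) 1))) ∧
    (0 < k → ∀ σ : ℝ, 0 < σ →
      RandomBilliard.IsStationary F c (RandomBilliard.hiddenGaussian k σ)
        (RandomBilliard.normalized (RandomBilliard.maxwellBoltzmann l σ))) := by
  refine ⟨?_, fun _ σ hσ => hF.isStationary_maxwellBoltzmann hc hσ⟩
  rintro rfl μ _
  exact ⟨hF.isStationary_cosineMeasure hc μ, RandomBilliard.bijOn_horiz_hemisphere l,
    RandomBilliard.map_horiz_normalized_cosineMeasure l⟩
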